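/- Let $d\ge 1$, let $\Omega\subset\mathbb R^d$ be closed and convex, let $\rho>0$, and let $\bar\mu$ be a probability measure on $\Omega$ with Lebesgue density $x\mapsto A\,[(\rho^2-|x|^2)\vee 0]$ on $\mathbb R^d$. Let $a,b\in\Omega$, and let $R:[0,1]\to[0,\infty)$ and $\bar x:[0,1]\to\mathbb R^d$ be continuous on $[0,1]$ and $C^2$ on $(0,1)$, with $R>0$ on $(0,1)$, $\bar x(0)=a$, $\bar x(1)=b$. Put $\mu_t=(x\mapsto R(t)x+\bar x(t))_\sharp\bar\mu$ and assume that every $\mu_t$, $t\in[0,1]$, is concentrated on $\Omega$. A velocity field of $\mu$ is a field $v$ with $v_t\in L^2(\mu_t)$ for a.e. $t$ and $\int\phi\,d\mu_{t_2}-\int\phi\,d\mu_{t_1}=\int_{t_1}^{t_2}\int\nabla\phi\cdot v_s\,d\mu_s\,ds$ for all $0\le t_1<t_2\le1$ and all compactly supported $C^1$ functions $\phi$ on $\mathbb R^d$ (the inner integral being integrable in $s$); a tangent field is a velocity field that for a.e. $t$ has minimal $L^2(\mu_t)$ norm among all velocity fields. Put $F(t)=\int_\Omega u(t,x)^2\,dx$,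 where $u(t,\cdot)$ is the density of $\mu_t$, $V(t)=\int|v_t|^2\,d\mu_t$, where $v$ is the tangent field, and $K=FV^{-1/2}$. When $K$ is a constant in $(0,\infty)$, we say that $\mu$ solves the system if, for suitable representatives ($u\ge 0$ continuous on $(0,1)\times\Omega$; $u$ and $v$ of class $C^1$ on $\{u>0\}=\{(t,x): 0<t<1,\ x\in\operatorname{int}\Omega,\ u(t,x)>0\}$; and $F V^{-1/2}=K$ at every $t\in(0,1)$), its density $u$ and its tangent field $v$ satisfy $$\begin{cases}-2V(t)^{1/2}\nabla u+K\left(v\cdot\nabla v+\partial_t v\right)=0&\text{in }\{u>0\},\\ \partial_t u+\nabla\cdot(vu)=0&\text{in }\Omega\text{, in the sense of distributions as above},\\ u\,v\cdot n=0&\text{on }\partial\Omega\text{ for every outward normal }n,\\ u(t,\cdot)\mathcal L^d\rightharpoonup\mu_0\ (t\downarrow0),\quad u(t,\cdot)\mathcal L^d\rightharpoonup\mu_1\ (t\uparrow1).\end{cases}$$ Then: (1) If $\mu$ is parametrized so that $K$ is (for a.e. $t$) a constant in $(0,\infty)$, then $\mu$ solves the system if and only if $\bar x(t)=(1-t)a+tb$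 for all $t\in[0,1]$ and $R$ is strictly concave on $[0,1]$. (2) $K$ is a constant in $(0,\infty)$ and $\mu$ solves the system if and only if $\bar x''=0$ on $(0,1)$, the function $R^{2d}\left(d\rho^2(R')^2+(d+4)|\bar x'|^2\right)$ is constant on $(0,1)$, and $R$ is strictly concave on $[0,1]$. -/

import Mathlib

open MeasureTheory Set Filter Topology
open scoped ENNReal

noncomputable section

namespace WassersteinConformal

/-- The functional `L_q` on measures: the integral of the `q`-th power of the Lebesgue density,
and `+∞` on measures that are not absolutely continuous. -/
def densityFunctional {d : ℕ} (q : ℝ) (ν : Measure (EuclideanSpace ℝ (Fin d))) : ℝ≥0∞ :=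
  open Classical in
  if ν ≪ volume then ∫⁻ x, (ν.rnDeriv volume x) ^ q else ⊤

/-- The continuity equation `∂ₜ μ + ∇ · (v μ) = 0` in the sense of distributions, on the time
interval `I`. The test functions are `C¹` with compact support in the whole space; for curves of
measures on a closed set `Ω` only their restrictions to `Ω` matter, so they represent `C¹_c(Ω)`
(they need not vanish on the boundary of `Ω`). -/
def ContinuityEquation {d : ℕ} (I : Set ℝ) (μ : ℝ → Measure (EuclideanSpace ℝ (Fin d)))
    (v : ℝ → EuclideanSpace ℝ (Fin d) → EuclideanSpace ℝ (Fin d)) : Prop :=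
  ∀ φ : EuclideanSpace ℝ (Fin d) → ℝ, ContDiff ℝ 1 φ → HasCompactSupport φ →
    ∀ t₁ ∈ I, ∀ t₂ ∈ I, t₁ < t₂ →
      IntervalIntegrable (fun s => ∫ x, inner ℝ (gradient φ x) (v s x) ∂(μ s)) volume t₁ t₂ ∧
      (∫ x, φ x ∂(μ t₂)) - (∫ x, φ x ∂(μ t₁))
        = ∫ s in t₁..t₂, ∫ x, inner ℝ (gradient φ x) (v s x) ∂(μ s)

/-- `v` is a velocity field of the curve `μ` on `[0,1]`. -/
def IsVelocityField {d : ℕ} (μ : ℝ → Measure (EuclideanSpace ℝ (Fin d)))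
    (v : ℝ → EuclideanSpace ℝ (Fin d) → EuclideanSpace ℝ (Fin d)) : Prop :=
  (∀ᵐ t ∂(volume.restrict (Icc (0 : ℝ) 1)), MemLp (v t) 2 (μ t)) ∧
    ContinuityEquation (Icc (0 : ℝ) 1) μ v

/-- `v` is a tangent field of the curve `μ`: a velocity field which has, for almost every time,
the minimal `L²(μ_t)` norm among all velocity fields. -/
def IsTangentField {d : ℕ} (μ : ℝ → Measure (EuclideanSpace ℝ (Fin d)))
    (v : ℝ → EuclideanSpace ℝ (Fin d) → EuclideanSpace ℝ (Fin d)) : Prop :=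
  IsVelocityField μ v ∧
    ∀ w : ℝ → EuclideanSpace ℝ (Fin d) → EuclideanSpace ℝ (Fin d), IsVelocityField μ w →
      ∀ᵐ t ∂(volume.restrict (Icc (0 : ℝ) 1)),
        eLpNorm (v t) 2 (μ t) ≤ eLpNorm (w t) 2 (μ t)

/-- `V(t) = ∫ |v_t|² dμ_t`. -/
def kineticV {d : ℕ} (μ : ℝ → Measure (EuclideanSpace ℝ (Fin d)))
    (v : ℝ → EuclideanSpace ℝ (Fin d) → EuclideanSpace ℝ (Fin d)) (t : ℝ) : ℝ≥0∞ :=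
  ∫⁻ x, ‖v t x‖ₑ ^ 2 ∂(μ t)

/-- `K(t) = F(t) V(t)^{-1/2}`, where `F(t) = L₂(μ_t)`; it is infinite where `V` vanishes and
`F` does not. -/
def coefficientK {d : ℕ} (μ : ℝ → Measure (EuclideanSpace ℝ (Fin d)))
    (v : ℝ → EuclideanSpace ℝ (Fin d) → EuclideanSpace ℝ (Fin d)) (t : ℝ) : ℝ≥0∞ :=
  densityFunctional 2 (μ t) * kineticV μ v t ^ (-(1 / 2) : ℝ)

/-- The curve `μ` is parametrised so that `K = F V^{-1/2}`, computed with the tangent field, is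
the (finite, positive) constant `K`. Tangent fields being determined for almost every time only,
so is the function `t ↦ V(t)`. -/
def HasConstantK {d : ℕ} (μ : ℝ → Measure (EuclideanSpace ℝ (Fin d))) (K : ℝ) : Prop :=
  0 < K ∧ ∃ v : ℝ → EuclideanSpace ℝ (Fin d) → EuclideanSpace ℝ (Fin d),
    IsTangentField μ v ∧
      ∀ᵐ t ∂(volume.restrict (Icc (0 : ℝ) 1)), coefficientK μ v t = ENNReal.ofReal K

/-- The measure on `Ω` with Lebesgue density `f`. -/
def densityMeasure {d : ℕ} (Ω : Set (EuclideanSpace ℝ (Fin d)))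
    (f : EuclideanSpace ℝ (Fin d) → ℝ) : Measure (EuclideanSpace ℝ (Fin d)) :=
  (volume.restrict Ω).withDensity fun x => ENNReal.ofReal (f x)

/-- The (open) region `{u > 0}` of space-time. -/
def positivitySet {d : ℕ} (Ω : Set (EuclideanSpace ℝ (Fin d)))
    (u : ℝ → EuclideanSpace ℝ (Fin d) → ℝ) : Set (ℝ × EuclideanSpace ℝ (Fin d)) :=
  {p | p.1 ∈ Ioo (0 : ℝ) 1 ∧ p.2 ∈ interior Ω ∧ 0 < u p.1 p.2}

/-- The pair `(u, v)` solves the system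
* `-2 V^{1/2} ∇u + K (v · ∇v + ∂ₜ v) = 0` in `{u > 0}`, classically,
* `∂ₜ u + ∇ · (v u) = 0` in `Ω`, in the sense of distributions,
* `u v · n = 0` on the boundary of `Ω`, for every outward normal `n`,
* `u_t 𝓛ᵈ → μ₀` as `t ↓ 0` and `u_t 𝓛ᵈ → μ₁` as `t ↑ 1`, weakly,

with the constant `K = F V^{-1/2}`. -/
structure SolvesSystem {d : ℕ} (Ω : Set (EuclideanSpace ℝ (Fin d)))
    (μ₀ μ₁ : Measure (EuclideanSpace ℝ (Fin d))) (K : ℝ)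
    (u : ℝ → EuclideanSpace ℝ (Fin d) → ℝ)
    (v : ℝ → EuclideanSpace ℝ (Fin d) → EuclideanSpace ℝ (Fin d)) : Prop where
  nonneg : ∀ t ∈ Ioo (0 : ℝ) 1, ∀ x ∈ Ω, 0 ≤ u t x
  continuousOn_density :
    ContinuousOn (fun p : ℝ × EuclideanSpace ℝ (Fin d) => u p.1 p.2) (Ioo (0 : ℝ) 1 ×ˢ Ω)
  contDiffOn_density :
    ContDiffOn ℝ 1 (fun p : ℝ × EuclideanSpace ℝ (Fin d) => u p.1 p.2) (positivitySet Ω u)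
  contDiffOn_velocity :
    ContDiffOn ℝ 1 (fun p : ℝ × EuclideanSpace ℝ (Fin d) => v p.1 p.2) (positivitySet Ω u)
  constantK : ∀ t ∈ Ioo (0 : ℝ) 1,
    coefficientK (fun s => densityMeasure Ω (u s)) v t = ENNReal.ofReal K
  momentum : ∀ t x, (t, x) ∈ positivitySet Ω u →
    -(2 * Real.sqrt (kineticV (fun s => densityMeasure Ω (u s)) v t).toReal) • gradient (u t) x
      + K • (fderiv ℝ (v t) x (v t x) + deriv (fun s => v s x) t) = 0
  continuity : ContinuityEquation (Ioo (0 : ℝ) 1) (fun s => densityMeasure Ω (u s)) v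
  no_flux : ∀ t ∈ Ioo (0 : ℝ) 1, ∀ x ∈ frontier Ω, ∀ n : EuclideanSpace ℝ (Fin d),
    (∀ y ∈ Ω, inner ℝ (y - x) n ≤ 0) → u t x * inner ℝ (v t x) n = 0
  initial : ∀ f : BoundedContinuousFunction (EuclideanSpace ℝ (Fin d)) ℝ,
    Tendsto (fun t => ∫ x, f x ∂(densityMeasure Ω (u t))) (𝓝[>] 0) (𝓝 (∫ x, f x ∂μ₀))
  final : ∀ f : BoundedContinuousFunction (EuclideanSpace ℝ (Fin d)) ℝ,
    Tendsto (fun t => ∫ x, f x ∂(densityMeasure Ω (u t))) (𝓝[<] 1) (𝓝 (∫ x, f x ∂μ₁))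

/-- The curve `μ` of measures on `Ω` solves the system together with its own tangent field: its
density `u` and its tangent field `v` (for suitable representatives of the two almost-everywhere
defined functions) solve it, with end points `μ 0` and `μ 1`. -/
def CurveSolvesSystem {d : ℕ} (Ω : Set (EuclideanSpace ℝ (Fin d)))
    (μ : ℝ → Measure (EuclideanSpace ℝ (Fin d))) (K : ℝ) : Prop :=
  ∃ (u : ℝ → EuclideanSpace ℝ (Fin d) → ℝ)
    (v : ℝ → EuclideanSpace ℝ (Fin d) → EuclideanSpace ℝ (Fin d)),
    (∀ t ∈ Ioo (0 : ℝ) 1, μ t = densityMeasure Ω (u t)) ∧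
      IsTangentField μ v ∧ SolvesSystem Ω (μ 0) (μ 1) K u v

/-- The curve `μ_t = (x ↦ R(t) x + x̄(t))_♯ μ̄`. -/
def movingHomothety {d : ℕ} (μbar : Measure (EuclideanSpace ℝ (Fin d))) (R : ℝ → ℝ)
    (xbar : ℝ → EuclideanSpace ℝ (Fin d)) (t : ℝ) : Measure (EuclideanSpace ℝ (Fin d)) :=
  μbar.map fun x => R t • x + xbar t

end WassersteinConformal

end

/-!
The flow velocity of a path of homotheties is, at each time, the gradient of a quadratic polynomial
in the space variable. The continuity equation, tested with the coordinates and with `‖y‖²`, shows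
that the difference of two velocity fields is orthogonal in `L²` to all such gradients; hence the
flow velocity has minimal norm, that is, it is the tangent field. On the moving ball the momentum
equation then becomes affine in `x` and splits into `x̄'' = 0` and the scalar equation
`d V + m R R'' = 0`, where `m` is the second moment of the profile. Since `F` is proportional to
`R⁻ᵈ`, constancy of `K` means that `R²ᵈ V` is constant, and when `x̄'' = 0` its derivative is a
multiple of `R' (d V + m R R'')`. A strictly concave `R` is critical at most once, so that the
scalar equation holds everywhere by continuity; conversely, it forces `R'' < 0` because `V > 0`.
-/

namespace WassersteinConformal

/-! ### Preliminaries on the calculus of functions and on `L²` -/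

section Interval

variable {E : Type*} [NormedAddCommGroup E] [NormedSpace ℝ E] {a b : ℝ}

theorem forall_deriv_deriv_eq_zero_iff_exists_affine {f : ℝ → E} (hab : a < b)
    (hf : ContinuousOn f (Icc a b)) (hf₁ : DifferentiableOn ℝ f (Ioo a b))
    (hf₂ : DifferentiableOn ℝ (deriv f) (Ioo a b)) :
    (∀ t ∈ Ioo a b, deriv (deriv f) t = 0) ↔ ∃ w, ∀ t ∈ Icc a b, f t = f a + (t - a) • w := by
  constructor
  · intro h
    obtain ⟨w, hw⟩ := isOpen_Ioo.exists_is_const_of_deriv_eq_zero isPreconnected_Ioo hf₂ h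
    have hderiv (t : ℝ) : HasDerivAt (fun t => f a + (t - a) • w) w t := by
      simpa using (((hasDerivAt_id t).sub_const a).smul_const w).const_add (f a)
    obtain ⟨k, hk⟩ := isOpen_Ioo.exists_eq_add_of_deriv_eq isPreconnected_Ioo hf₁
      (fun t _ => (hderiv t).differentiableAt.differentiableWithinAt)
      fun t ht => (hw t ht).trans (hderiv t).deriv.symm
    have hclosed : EqOn f (fun t => f a + (t - a) • w + k) (Icc a b) :=
      hk.of_subset_closure hf (by fun_prop) Ioo_subset_Icc_self (closure_Ioo hab.ne).ge
    have hk0 : k = 0 := by simpa using hclosed (left_mem_Icc.2 hab.le)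
    exact ⟨w, fun t ht => by simpa [hk0] using hclosed ht⟩
  · rintro ⟨w, hw⟩ t ht
    have hderiv : EqOn (deriv f) (fun _ => w) (Ioo a b) := fun s hs => by
      have haffine : f =ᶠ[𝓝 s] fun s => f a + (s - a) • w := by
        filter_upwards [Icc_mem_nhds hs.1 hs.2] with r hr using hw r hr
      rw [haffine.deriv_eq]
      simpa using ((((hasDerivAt_id s).sub_const a).smul_const w).const_add (f a)).deriv
    rw [(hderiv.eventuallyEq_of_mem (Ioo_mem_nhds ht.1 ht.2)).deriv_eq, deriv_const]

theorem intervalIntegrable_deriv_of_forall_le {f f' : ℝ → ℝ} {m : ℝ} (hab : a ≤ b)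
    (hf : ContinuousOn f (Icc a b)) (hderiv : ∀ t ∈ Ioo a b, HasDerivAt f (f' t) t)
    (hm : ∀ t ∈ Ioo a b, m ≤ f' t) : IntervalIntegrable f' volume a b := by
  have hsub : IntervalIntegrable (fun t => f' t - m) volume a b := by
    refine (intervalIntegrable_iff_integrableOn_Ioc_of_le hab).2 <|
      intervalIntegral.integrableOn_deriv_of_nonneg (g := fun t => f t - t * m)
        (hf.sub (by fun_prop)) (fun t ht => ?_) fun t ht => sub_nonneg.2 (hm t ht)
    exact (hderiv t ht).sub (hasDerivAt_mul_const m)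
  simpa using hsub.add (intervalIntegrable_const (c := m))

theorem intervalIntegrable_deriv_of_antitoneOn {f f' : ℝ → ℝ} (hab : a < b)
    (hf : ContinuousOn f (Icc a b)) (hderiv : ∀ t ∈ Ioo a b, HasDerivAt f (f' t) t)
    (hanti : AntitoneOn f' (Ioo a b)) : IntervalIntegrable f' volume a b := by
  obtain ⟨c, hc⟩ := exists_between hab
  have left : IntervalIntegrable f' volume a c :=
    intervalIntegrable_deriv_of_forall_le hc.1.le (hf.mono (Icc_subset_Icc_right hc.2.le))
      (fun t ht => hderiv t (Ioo_subset_Ioo_right hc.2.le ht))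
      fun t ht => hanti (Ioo_subset_Ioo_right hc.2.le ht) hc ht.2.le
  have right : IntervalIntegrable (-f') volume c b :=
    intervalIntegrable_deriv_of_forall_le hc.2.le (hf.mono (Icc_subset_Icc_left hc.1.le)).neg
      (fun t ht => (hderiv t (Ioo_subset_Ioo_left hc.1.le ht)).neg)
      fun t ht => neg_le_neg (hanti hc (Ioo_subset_Ioo_left hc.1.le ht) ht.1.le)
  exact left.trans (by simpa using right.neg)

end Interval

section Gradient

variable {E : Type*} [NormedAddCommGroup E] [InnerProductSpace ℝ E] [CompleteSpace E]

theorem continuous_gradient {φ : E → ℝ} (hφ : ContDiff ℝ 1 φ) : Continuous (gradient φ) :=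
  (InnerProductSpace.toDual ℝ E).symm.continuous.comp (hφ.continuous_fderiv one_ne_zero)

theorem gradient_inner (e x : E) : gradient (fun y : E => (inner ℝ e y : ℝ)) x = e :=
  HasGradientAt.gradient (hasGradientAt_iff_hasFDerivAt.2 (innerSL ℝ e).hasFDerivAt)

theorem hasGradientAt_norm_sq (x : E) : HasGradientAt (fun y : E => ‖y‖ ^ 2) ((2 : ℝ) • x) x := by
  rw [hasGradientAt_iff_hasFDerivAt, map_smul, two_smul, ← two_nsmul]
  exact (hasStrictFDerivAt_norm_sq x).hasFDerivAt

end Gradient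

section L2

variable {α E : Type*} [MeasurableSpace α] {μ : Measure α} [NormedAddCommGroup E]
  [InnerProductSpace ℝ E] {f g : α → E}

theorem integrable_inner (hf : MemLp f 2 μ) (hg : MemLp g 2 μ) :
    Integrable (fun x => (inner ℝ (f x) (g x) : ℝ)) μ := by
  refine (L2.integrable_inner (𝕜 := ℝ) (hf.toLp f) (hg.toLp g)).congr ?_
  filter_upwards [hf.coeFn_toLp, hg.coeFn_toLp] with x hfx hgx
  rw [hfx, hgx]

theorem eLpNorm_add_sq_of_integral_inner_eq_zero (hf : MemLp f 2 μ) (hg : MemLp g 2 μ)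
    (horth : ∫ x, inner ℝ (f x) (g x) ∂μ = 0) :
    eLpNorm (f + g) 2 μ ^ 2 = eLpNorm f 2 μ ^ 2 + eLpNorm g 2 μ ^ 2 := by
  have horth' : inner ℝ (hf.toLp f) (hg.toLp g) = 0 := by
    rw [L2.inner_def, ← horth]
    refine integral_congr_ae ?_
    filter_upwards [hf.coeFn_toLp, hg.coeFn_toLp] with x hfx hgx
    rw [hfx, hgx]
  have hpyth := norm_add_sq_eq_norm_sq_add_norm_sq_real horth'
  rw [← MemLp.toLp_add] at hpyth
  simp only [Lp.norm_toLp, ← sq] at hpyth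
  rw [← ENNReal.toReal_eq_toReal_iff' (by simp [(hf.add hg).2.ne])
    (by simp [hf.2.ne, hg.2.ne]), ENNReal.toReal_add (by simp [hf.2.ne]) (by simp [hg.2.ne])]
  simpa using hpyth

theorem eLpNorm_le_of_integral_inner_sub_eq_zero (hf : MemLp f 2 μ) (hg : MemLp g 2 μ)
    (horth : ∫ x, inner ℝ (f x) (g x - f x) ∂μ = 0) : eLpNorm f 2 μ ≤ eLpNorm g 2 μ := by
  have hpyth := eLpNorm_add_sq_of_integral_inner_eq_zero hf (hg.sub hf) horth
  rw [add_sub_cancel] at hpyth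
  exact (ENNReal.pow_le_pow_left_iff two_ne_zero).1 (hpyth ▸ le_self_add)

theorem ae_eq_of_integral_inner_sub_eq_zero (hf : MemLp f 2 μ) (hg : MemLp g 2 μ)
    (horth : ∫ x, inner ℝ (f x) (g x - f x) ∂μ = 0) (hle : eLpNorm g 2 μ ≤ eLpNorm f 2 μ) :
    g =ᵐ[μ] f := by
  have hpyth := eLpNorm_add_sq_of_integral_inner_eq_zero hf (hg.sub hf) horth
  rw [add_sub_cancel] at hpyth
  have hzero : eLpNorm (g - f) 2 μ ^ 2 ≤ 0 := by
    refine (ENNReal.add_le_add_iff_left (a := eLpNorm f 2 μ ^ 2) (by simp [hf.2.ne])).1 ?_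
    rw [← hpyth, add_zero]
    exact pow_le_pow_left' hle 2
  refine (sub_ae_eq_zero g f).1 ((eLpNorm_eq_zero_iff (hg.sub hf).1 two_ne_zero).1 ?_)
  exact eq_zero_of_pow_eq_zero (n := 2) (nonpos_iff_eq_zero.1 hzero)

theorem integral_inner_smul_add_eq_zero [CompleteSpace E]
    (hfg : Integrable (fun x => (inner ℝ (f x) (g x) : ℝ)) μ) (hg : Integrable g μ)
    (hradial : ∫ x, inner ℝ (f x) (g x) ∂μ = 0) (hmean : ∫ x, g x ∂μ = 0) (a : ℝ) (e : E) :
    ∫ x, inner ℝ (a • f x + e) (g x) ∂μ = 0 := by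
  simp only [inner_add_left, real_inner_smul_left]
  rw [integral_add (hfg.const_mul a) (hg.const_inner e), integral_const_mul, integral_inner hg,
    hradial, hmean, mul_zero, inner_zero_right, add_zero]

end L2

theorem memLp_of_continuous_of_ae_norm_le {E F : Type*} [NormedAddCommGroup E] [ProperSpace E]
    [MeasurableSpace E] [OpensMeasurableSpace E] [NormedAddCommGroup F] {μ : Measure E}
    [IsFiniteMeasure μ] {r : ℝ} (hμ : ∀ᵐ x ∂μ, ‖x‖ ≤ r) {f : E → F} (hf : Continuous f)
    (p : ℝ≥0∞) : MemLp f p μ := by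
  obtain ⟨C, hC⟩ := (isCompact_closedBall (0 : E) r).exists_bound_of_continuousOn hf.continuousOn
  exact .of_bound hf.aestronglyMeasurable C <|
    hμ.mono fun x hx => hC x (mem_closedBall_zero_iff.2 hx)

section ParametricIntegral

variable {X E : Type*} [TopologicalSpace X] [T2Space X] [MeasurableSpace X]
  [OpensMeasurableSpace X] {ν : Measure X} [IsFiniteMeasure ν] [NormedAddCommGroup E]
  [NormedSpace ℝ E] {k : Set X}

theorem hasDerivAt_integral_of_isCompact (hk : IsCompact k) (hν : ∀ᵐ x ∂ν, x ∈ k) {U : Set ℝ}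
    (hU : IsOpen U) {F F' : ℝ → X → E} (hF : ∀ t ∈ U, ContinuousOn (F t) k)
    (hF' : ContinuousOn (Function.uncurry F') (U ×ˢ k))
    (hderiv : ∀ t ∈ U, ∀ x ∈ k, HasDerivAt (F · x) (F' t x) t) {t : ℝ} (ht : t ∈ U) :
    HasDerivAt (fun s => ∫ x, F s x ∂ν) (∫ x, F' t x ∂ν) t := by
  obtain ⟨J, hJ, hJU, hJc⟩ := local_compact_nhds (hU.mem_nhds ht)
  obtain ⟨C, hC⟩ := (hJc.prod hk).exists_bound_of_continuousOn
    (hF'.mono (prod_mono_left hJU))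
  have hmeas {f : X → E} (hf : ContinuousOn f k) : AEStronglyMeasurable f ν := by
    rw [← Measure.restrict_eq_self_of_ae_mem hν]
    exact hf.aestronglyMeasurable_of_isCompact hk hk.measurableSet
  obtain ⟨B, hB⟩ := hk.exists_bound_of_continuousOn (hF t ht)
  refine (hasDerivAt_integral_of_dominated_loc_of_deriv_le (bound := fun _ => C) hJ ?_
    (.of_bound (hmeas (hF t ht)) B (hν.mono hB)) (hmeas ?_) ?_ (integrable_const C) ?_).2
  · filter_upwards [hJ] with s hs using hmeas (hF s (hJU hs))
  · exact hF'.uncurry_left t ht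
  · filter_upwards [hν] with x hx s hs using hC (s, x) ⟨hs, hx⟩
  · filter_upwards [hν] with x hx s hs using hderiv s (hJU hs) x hx

end ParametricIntegral

/-! ### The tangent field of a path of homotheties -/

section MovingHomothety

variable {d : ℕ} {ν : Measure (EuclideanSpace ℝ (Fin d))} {ρ : ℝ} {R : ℝ → ℝ}
  {xbar : ℝ → EuclideanSpace ℝ (Fin d)} {t : ℝ}

instance [IsProbabilityMeasure ν] : IsProbabilityMeasure (movingHomothety ν R xbar t) :=
  Measure.isProbabilityMeasure_map (by fun_prop)

instance [IsFiniteMeasure ν] : IsFiniteMeasure (movingHomothety ν R xbar t) :=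
  Measure.isFiniteMeasure_map ν _

theorem integral_movingHomothety {F : Type*} [NormedAddCommGroup F] [NormedSpace ℝ F]
    {f : EuclideanSpace ℝ (Fin d) → F} (hf : Continuous f) :
    ∫ y, f y ∂(movingHomothety ν R xbar t) = ∫ x, f (R t • x + xbar t) ∂ν :=
  integral_map (by fun_prop) hf.aestronglyMeasurable

theorem ae_norm_le_movingHomothety (hν : ∀ᵐ x ∂ν, ‖x‖ ≤ ρ) :
    ∀ᵐ y ∂(movingHomothety ν R xbar t), ‖y‖ ≤ ‖R t‖ * ρ + ‖xbar t‖ := by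
  rw [movingHomothety, ae_map_iff (by fun_prop) (measurableSet_le (by fun_prop) (by fun_prop))]
  filter_upwards [hν] with x hx
  calc ‖R t • x + xbar t‖ ≤ ‖R t‖ * ‖x‖ + ‖xbar t‖ := norm_smul (R t) x ▸ norm_add_le _ _
    _ ≤ ‖R t‖ * ρ + ‖xbar t‖ := by gcongr

theorem memLp_movingHomothety [IsFiniteMeasure ν] (hν : ∀ᵐ x ∂ν, ‖x‖ ≤ ρ) {F : Type*}
    [NormedAddCommGroup F] {f : EuclideanSpace ℝ (Fin d) → F} (hf : Continuous f) (p : ℝ≥0∞) :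
    MemLp f p (movingHomothety ν R xbar t) :=
  memLp_of_continuous_of_ae_norm_le (ae_norm_le_movingHomothety hν) hf p

end MovingHomothety

/-- The velocity `(R'/R) (y - x̄) + x̄'` of the flow `x ↦ R(t) x + x̄(t)`, as a function of the
current position `y`. -/
noncomputable def homothetyVelocity {E : Type*} [NormedAddCommGroup E] [NormedSpace ℝ E]
    (R : ℝ → ℝ) (xbar : ℝ → E) (t : ℝ) (y : E) : E :=
  (deriv R t / R t) • (y - xbar t) + deriv xbar t

section HomothetyVelocity

variable {E : Type*} [NormedAddCommGroup E] [NormedSpace ℝ E] {R : ℝ → ℝ} {xbar : ℝ → E}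

theorem homothetyVelocity_smul_add {t : ℝ} (hR : R t ≠ 0) (x : E) :
    homothetyVelocity R xbar t (R t • x + xbar t) = deriv R t • x + deriv xbar t := by
  rw [homothetyVelocity, add_sub_cancel_right, smul_smul, div_mul_cancel₀ _ hR]

theorem homothetyVelocity_eq_smul_add (t : ℝ) (y : E) : homothetyVelocity R xbar t y
    = (deriv R t / R t) • y + (deriv xbar t - (deriv R t / R t) • xbar t) := by
  rw [homothetyVelocity, smul_sub]
  abel

theorem continuous_homothetyVelocity (t : ℝ) : Continuous (homothetyVelocity R xbar t) := by
  unfold homothetyVelocity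
  fun_prop

end HomothetyVelocity

/-- The regularity of a path `x ↦ R(t) x + x̄(t)` of homotheties: continuous for `t ∈ [0,1]`, twice
continuously differentiable and nondegenerate for `t ∈ (0,1)`. The scale may vanish at the end
points. -/
structure IsHomothetyPath {E : Type*} [NormedAddCommGroup E] [NormedSpace ℝ E] (R : ℝ → ℝ)
    (xbar : ℝ → E) : Prop where
  scale_continuousOn : ContinuousOn R (Icc 0 1)
  scale_contDiffOn : ContDiffOn ℝ 2 R (Ioo 0 1)
  scale_pos : ∀ t ∈ Ioo (0 : ℝ) 1, 0 < R t
  center_continuousOn : ContinuousOn xbar (Icc 0 1)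
  center_contDiffOn : ContDiffOn ℝ 2 xbar (Ioo 0 1)

namespace IsHomothetyPath

section Derivatives

variable {E : Type*} [NormedAddCommGroup E] [NormedSpace ℝ E] {R : ℝ → ℝ} {xbar : ℝ → E} {t : ℝ}

theorem contDiffOn_deriv_scale (c : IsHomothetyPath R xbar) : ContDiffOn ℝ 1 (deriv R) (Ioo 0 1) :=
  c.scale_contDiffOn.deriv_of_isOpen isOpen_Ioo one_add_one_eq_two.le

theorem contDiffOn_deriv_center (c : IsHomothetyPath R xbar) :
    ContDiffOn ℝ 1 (deriv xbar) (Ioo 0 1) :=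
  c.center_contDiffOn.deriv_of_isOpen isOpen_Ioo one_add_one_eq_two.le

theorem hasDerivAt_scale (c : IsHomothetyPath R xbar) (ht : t ∈ Ioo (0 : ℝ) 1) :
    HasDerivAt R (deriv R t) t :=
  ((c.scale_contDiffOn.differentiableOn two_ne_zero).differentiableAt
    (isOpen_Ioo.mem_nhds ht)).hasDerivAt

theorem hasDerivAt_center (c : IsHomothetyPath R xbar) (ht : t ∈ Ioo (0 : ℝ) 1) :
    HasDerivAt xbar (deriv xbar t) t :=
  ((c.center_contDiffOn.differentiableOn two_ne_zero).differentiableAt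
    (isOpen_Ioo.mem_nhds ht)).hasDerivAt

theorem hasDerivAt_deriv_scale (c : IsHomothetyPath R xbar) (ht : t ∈ Ioo (0 : ℝ) 1) :
    HasDerivAt (deriv R) (deriv (deriv R) t) t :=
  ((c.contDiffOn_deriv_scale.differentiableOn one_ne_zero).differentiableAt
    (isOpen_Ioo.mem_nhds ht)).hasDerivAt

theorem hasDerivAt_deriv_center (c : IsHomothetyPath R xbar) (ht : t ∈ Ioo (0 : ℝ) 1) :
    HasDerivAt (deriv xbar) (deriv (deriv xbar) t) t :=
  ((c.contDiffOn_deriv_center.differentiableOn one_ne_zero).differentiableAt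
    (isOpen_Ioo.mem_nhds ht)).hasDerivAt

end Derivatives

theorem exists_forall_ae_norm_lt {d : ℕ} {ν : Measure (EuclideanSpace ℝ (Fin d))} {ρ : ℝ}
    {R : ℝ → ℝ} {xbar : ℝ → EuclideanSpace ℝ (Fin d)} (c : IsHomothetyPath R xbar)
    (hν : ∀ᵐ x ∂ν, ‖x‖ ≤ ρ) :
    ∃ M > 0, ∀ t ∈ Icc (0 : ℝ) 1, ∀ᵐ y ∂(movingHomothety ν R xbar t), ‖y‖ < M := by
  have hcont : ContinuousOn (fun t => ‖R t‖ * ρ + ‖xbar t‖) (Icc 0 1) :=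
    (c.scale_continuousOn.norm.mul continuousOn_const).add c.center_continuousOn.norm
  obtain ⟨C, hC⟩ := isCompact_Icc.exists_bound_of_continuousOn hcont
  refine ⟨C + 1, by linarith [(norm_nonneg _).trans (hC 0 (by simp))], fun t ht => ?_⟩
  filter_upwards [ae_norm_le_movingHomothety hν] with y hy
  linarith [(Real.le_norm_self _).trans (hC t ht)]

section TangentField

variable {d : ℕ} {ν : Measure (EuclideanSpace ℝ (Fin d))} [IsFiniteMeasure ν] {ρ : ℝ} {R : ℝ → ℝ}
  {xbar : ℝ → EuclideanSpace ℝ (Fin d)}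
  {w : ℝ → EuclideanSpace ℝ (Fin d) → EuclideanSpace ℝ (Fin d)}

theorem continuousOn_integral (c : IsHomothetyPath R xbar) {φ : EuclideanSpace ℝ (Fin d) → ℝ}
    (hφ : Continuous φ) {C : ℝ} (hC : ∀ x, ‖φ x‖ ≤ C) :
    ContinuousOn (fun t => ∫ x, φ x ∂(movingHomothety ν R xbar t)) (Icc 0 1) := by
  simp only [integral_movingHomothety hφ]
  refine continuousOn_of_dominated (bound := fun _ => C)
    (fun t _ => (hφ.comp (by fun_prop)).aestronglyMeasurable) (fun t _ => .of_forall fun x => hC _)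
    (integrable_const C) (.of_forall fun x => ?_)
  exact hφ.comp_continuousOn
    ((c.scale_continuousOn.smul continuousOn_const).add c.center_continuousOn)

theorem hasDerivAt_integral (c : IsHomothetyPath R xbar) (hν : ∀ᵐ x ∂ν, ‖x‖ ≤ ρ)
    {φ : EuclideanSpace ℝ (Fin d) → ℝ} (hφ : ContDiff ℝ 1 φ) {t : ℝ} (ht : t ∈ Ioo (0 : ℝ) 1) :
    HasDerivAt (fun s => ∫ x, φ x ∂(movingHomothety ν R xbar s))
      (∫ x, inner ℝ (gradient φ x) (homothetyVelocity R xbar t x)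
        ∂(movingHomothety ν R xbar t)) t := by
  have hgrad := continuous_gradient hφ
  rw [integral_movingHomothety (hgrad.inner (continuous_homothetyVelocity t))]
  simp only [integral_movingHomothety hφ.continuous,
    homothetyVelocity_smul_add (c.scale_pos t ht).ne']
  have hcontinuous {F : Type} [TopologicalSpace F] {g : ℝ → F} (hg : ContinuousOn g (Ioo 0 1)) :
      ContinuousOn (fun p : ℝ × EuclideanSpace ℝ (Fin d) => g p.1)
        (Ioo 0 1 ×ˢ Metric.closedBall 0 ρ) :=
    hg.comp continuousOn_fst fun p hp => hp.1
  refine hasDerivAt_integral_of_isCompact (isCompact_closedBall 0 ρ)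
    (hν.mono fun x hx => mem_closedBall_zero_iff.2 hx) isOpen_Ioo
    (F := fun s x => φ (R s • x + xbar s))
    (F' := fun s x => inner ℝ (gradient φ (R s • x + xbar s)) (deriv R s • x + deriv xbar s))
    (fun s _ => (hφ.continuous.comp (by fun_prop)).continuousOn) ?_ (fun s hs x _ => ?_) ht
  · refine (hgrad.comp_continuousOn ?_).inner ?_
    · exact ((hcontinuous c.scale_contDiffOn.continuousOn).smul continuousOn_snd).add
        (hcontinuous c.center_contDiffOn.continuousOn)
    · exact ((hcontinuous c.contDiffOn_deriv_scale.continuousOn).smul continuousOn_snd).add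
        (hcontinuous c.contDiffOn_deriv_center.continuousOn)
  · rw [inner_gradient_left]
    exact (hφ.differentiable one_ne_zero _).hasFDerivAt.comp_hasDerivAt s
      (((c.hasDerivAt_scale hs).smul_const x).add (c.hasDerivAt_center hs))

theorem ae_integral_gradient_eq_of_hasCompactSupport (c : IsHomothetyPath R xbar)
    (hν : ∀ᵐ x ∂ν, ‖x‖ ≤ ρ) (hw : IsVelocityField (movingHomothety ν R xbar) w)
    {φ : EuclideanSpace ℝ (Fin d) → ℝ} (hφ : ContDiff ℝ 1 φ) (hφc : HasCompactSupport φ) :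
    ∀ᵐ t ∂(volume.restrict (Icc (0 : ℝ) 1)),
      ∫ x, inner ℝ (gradient φ x) (w t x) ∂(movingHomothety ν R xbar t)
        = ∫ x, inner ℝ (gradient φ x) (homothetyVelocity R xbar t x)
            ∂(movingHomothety ν R xbar t) := by
  have hcont := hw.2 φ hφ hφc 0 (by simp)
  rw [← Measure.restrict_congr_set Ioo_ae_eq_Icc, ae_restrict_iff' measurableSet_Ioo]
  filter_upwards [(hcont 1 (by simp) one_pos).1.ae_hasDerivAt_integral] with t hprimitive ht
  rw [uIcc_of_le zero_le_one] at hprimitive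
  refine (hprimitive (Ioo_subset_Icc_self ht) 0 (by simp)).unique <|
    ((c.hasDerivAt_integral hν hφ ht).sub_const
      (∫ x, φ x ∂(movingHomothety ν R xbar 0))).congr_of_eventuallyEq ?_
  filter_upwards [Ioo_mem_nhds ht.1 ht.2] with s hs
  exact (hcont s (Ioo_subset_Icc_self hs) hs.1).2.symm

/-- The measures of the curve are supported in a common ball, hence test functions may be cut off
outside of it. -/
theorem ae_integral_gradient_eq (c : IsHomothetyPath R xbar) (hν : ∀ᵐ x ∂ν, ‖x‖ ≤ ρ)
    (hw : IsVelocityField (movingHomothety ν R xbar) w) {φ : EuclideanSpace ℝ (Fin d) → ℝ}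
    (hφ : ContDiff ℝ 1 φ) :
    ∀ᵐ t ∂(volume.restrict (Icc (0 : ℝ) 1)),
      ∫ x, inner ℝ (gradient φ x) (w t x) ∂(movingHomothety ν R xbar t)
        = ∫ x, inner ℝ (gradient φ x) (homothetyVelocity R xbar t x)
            ∂(movingHomothety ν R xbar t) := by
  obtain ⟨M, hM, hsupp⟩ := c.exists_forall_ae_norm_lt hν
  let χ : ContDiffBump (0 : EuclideanSpace ℝ (Fin d)) := ⟨M, M + 1, hM, lt_add_one M⟩
  have hgrad {y : EuclideanSpace ℝ (Fin d)} (hy : ‖y‖ < M) :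
      gradient (fun x => χ x * φ x) y = gradient φ y := by
    refine Filter.EventuallyEq.gradient_eq ?_
    filter_upwards [χ.eventuallyEq_one_of_mem_ball (mem_ball_zero_iff.2 hy)] with z hz
    rw [hz, Pi.one_apply, one_mul]
  filter_upwards [c.ae_integral_gradient_eq_of_hasCompactSupport hν hw (χ.contDiff.mul hφ)
    χ.hasCompactSupport.mul_right, ae_restrict_mem measurableSet_Icc] with t heq ht
  have hcutoff (v : EuclideanSpace ℝ (Fin d) → EuclideanSpace ℝ (Fin d)) :
      ∫ x, inner ℝ (gradient (fun x => χ x * φ x) x) (v x) ∂(movingHomothety ν R xbar t)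
        = ∫ x, inner ℝ (gradient φ x) (v x) ∂(movingHomothety ν R xbar t) := by
    refine integral_congr_ae ?_
    filter_upwards [hsupp t ht] with y hy
    rw [hgrad hy]
  rwa [hcutoff, hcutoff] at heq

theorem ae_integral_gradient_inner_sub_eq_zero (c : IsHomothetyPath R xbar)
    (hν : ∀ᵐ x ∂ν, ‖x‖ ≤ ρ) (hw : IsVelocityField (movingHomothety ν R xbar) w)
    {φ : EuclideanSpace ℝ (Fin d) → ℝ} (hφ : ContDiff ℝ 1 φ) :
    ∀ᵐ t ∂(volume.restrict (Icc (0 : ℝ) 1)),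
      ∫ x, inner ℝ (gradient φ x) (w t x - homothetyVelocity R xbar t x)
        ∂(movingHomothety ν R xbar t) = 0 := by
  filter_upwards [c.ae_integral_gradient_eq hν hw hφ, hw.1] with t heq hwt
  have hgrad := memLp_movingHomothety (R := R) (xbar := xbar) (t := t) hν
    (continuous_gradient hφ) 2
  simp only [inner_sub_right]
  rw [integral_sub (integrable_inner hgrad hwt) (integrable_inner hgrad
    (memLp_movingHomothety hν (continuous_homothetyVelocity t) 2)), heq, sub_self]

/-- At each time the flow velocity is the gradient of a quadratic polynomial, so it suffices to test
with the coordinates and with `‖y‖²`, which do not depend on time. -/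
theorem ae_integral_inner_sub_eq_zero (c : IsHomothetyPath R xbar) (hν : ∀ᵐ x ∂ν, ‖x‖ ≤ ρ)
    (hw : IsVelocityField (movingHomothety ν R xbar) w) :
    ∀ᵐ t ∂(volume.restrict (Icc (0 : ℝ) 1)),
      ∫ x, inner ℝ (homothetyVelocity R xbar t x) (w t x - homothetyVelocity R xbar t x)
        ∂(movingHomothety ν R xbar t) = 0 := by
  have hcoord := ae_all_iff.2 fun i : Fin d => c.ae_integral_gradient_inner_sub_eq_zero hν hw
    (φ := fun y => inner ℝ (EuclideanSpace.single i (1 : ℝ)) y) (contDiff_const.inner ℝ contDiff_id)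
  have hquad := c.ae_integral_gradient_inner_sub_eq_zero hν hw (contDiff_norm_sq ℝ)
  simp only [gradient_inner, (hasGradientAt_norm_sq _).gradient, real_inner_smul_left,
    integral_const_mul, mul_eq_zero, OfNat.ofNat_ne_zero, false_or] at hcoord hquad
  filter_upwards [hcoord, hquad, hw.1] with t hcoord hradial hwt
  have hdiff : MemLp (fun x => w t x - homothetyVelocity R xbar t x) 2
      (movingHomothety ν R xbar t) :=
    hwt.sub (memLp_movingHomothety hν (continuous_homothetyVelocity t) 2)
  have hmean : ∫ x, w t x - homothetyVelocity R xbar t x ∂(movingHomothety ν R xbar t) = 0 := by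
    ext i
    have hi := hcoord i
    rw [integral_inner (hdiff.integrable one_le_two)] at hi
    simpa [EuclideanSpace.inner_single_left] using hi
  have horth := integral_inner_smul_add_eq_zero
    (integrable_inner (memLp_movingHomothety hν continuous_id 2) hdiff)
    (hdiff.integrable one_le_two) hradial hmean (deriv R t / R t)
    (deriv xbar t - (deriv R t / R t) • xbar t)
  simpa only [homothetyVelocity_eq_smul_add, id] using horth

theorem isVelocityField_of_exists (c : IsHomothetyPath R xbar) (hν : ∀ᵐ x ∂ν, ‖x‖ ≤ ρ)
    (hw : IsVelocityField (movingHomothety ν R xbar) w) :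
    IsVelocityField (movingHomothety ν R xbar) (homothetyVelocity R xbar) := by
  refine ⟨.of_forall fun t => memLp_movingHomothety hν (continuous_homothetyVelocity t) 2,
    fun φ hφ hφc t₁ ht₁ t₂ ht₂ h12 => ?_⟩
  obtain ⟨hint, heq⟩ := hw.2 φ hφ hφc t₁ ht₁ t₂ ht₂ h12
  have hae := ae_restrict_of_ae_restrict_of_subset
    ((uIoc_of_le h12.le).trans_subset (Ioc_subset_Icc_self.trans (Icc_subset_Icc ht₁.1 ht₂.2)))
    (c.ae_integral_gradient_eq hν hw hφ)
  exact ⟨hint.congr_ae hae, heq.trans (intervalIntegral.integral_congr_ae_restrict hae)⟩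

theorem isTangentField_of_exists (c : IsHomothetyPath R xbar) (hν : ∀ᵐ x ∂ν, ‖x‖ ≤ ρ)
    (hw : IsVelocityField (movingHomothety ν R xbar) w) :
    IsTangentField (movingHomothety ν R xbar) (homothetyVelocity R xbar) := by
  refine ⟨c.isVelocityField_of_exists hν hw, fun w' hw' => ?_⟩
  filter_upwards [c.ae_integral_inner_sub_eq_zero hν hw', hw'.1] with t horth hw't
  exact eLpNorm_le_of_integral_inner_sub_eq_zero
    (memLp_movingHomothety hν (continuous_homothetyVelocity t) 2) hw't horth

theorem ae_eq_homothetyVelocity (c : IsHomothetyPath R xbar) (hν : ∀ᵐ x ∂ν, ‖x‖ ≤ ρ)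
    (hw : IsTangentField (movingHomothety ν R xbar) w) :
    ∀ᵐ t ∂(volume.restrict (Icc (0 : ℝ) 1)),
      w t =ᵐ[movingHomothety ν R xbar t] homothetyVelocity R xbar t := by
  filter_upwards [c.ae_integral_inner_sub_eq_zero hν hw.1, hw.1.1,
    hw.2 _ (c.isVelocityField_of_exists hν hw.1)] with t horth hwt hle
  exact ae_eq_of_integral_inner_sub_eq_zero
    (memLp_movingHomothety hν (continuous_homothetyVelocity t) 2) hwt horth hle

theorem norm_integral_gradient_le (c : IsHomothetyPath R xbar) (hν : ∀ᵐ x ∂ν, ‖x‖ ≤ ρ)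
    {φ : EuclideanSpace ℝ (Fin d) → ℝ} (hφ : ContDiff ℝ 1 φ) {C : ℝ}
    (hC : ∀ x, ‖gradient φ x‖ ≤ C) {t : ℝ} (ht : t ∈ Ioo (0 : ℝ) 1) :
    ‖∫ x, inner ℝ (gradient φ x) (homothetyVelocity R xbar t x) ∂(movingHomothety ν R xbar t)‖
      ≤ C * (‖deriv R t‖ * ρ + ‖deriv xbar t‖) * ν.real univ := by
  rw [integral_movingHomothety
    ((continuous_gradient hφ).inner (continuous_homothetyVelocity t))]
  refine norm_integral_le_of_norm_le_const ?_
  filter_upwards [hν] with x hx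
  rw [homothetyVelocity_smul_add (c.scale_pos t ht).ne']
  calc ‖(inner ℝ (gradient φ (R t • x + xbar t)) (deriv R t • x + deriv xbar t) : ℝ)‖
      ≤ ‖gradient φ (R t • x + xbar t)‖ * ‖deriv R t • x + deriv xbar t‖ := norm_inner_le_norm _ _
    _ ≤ C * (‖deriv R t‖ * ρ + ‖deriv xbar t‖) := by
        refine mul_le_mul (hC _) ((norm_add_le _ _).trans ?_) (norm_nonneg _)
          ((norm_nonneg _).trans (hC 0))
        rw [norm_smul]
        gcongr

theorem isVelocityField_of_intervalIntegrable (c : IsHomothetyPath R xbar)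
    (hν : ∀ᵐ x ∂ν, ‖x‖ ≤ ρ) (hR : IntervalIntegrable (deriv R) volume 0 1)
    (hx : IntervalIntegrable (deriv xbar) volume 0 1) :
    IsVelocityField (movingHomothety ν R xbar) (homothetyVelocity R xbar) := by
  refine ⟨.of_forall fun t => memLp_movingHomothety hν (continuous_homothetyVelocity t) 2,
    fun φ hφ hφc t₁ ht₁ t₂ ht₂ h12 => ?_⟩
  obtain ⟨B, hB⟩ := hφ.continuous.bounded_above_of_compact_support hφc
  obtain ⟨C, hC⟩ := hφ.lipschitzWith_of_hasCompactSupport hφc one_ne_zero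
  have hgrad (x : EuclideanSpace ℝ (Fin d)) : ‖gradient φ x‖ ≤ C := by
    rw [gradient, LinearIsometryEquiv.norm_map]
    exact norm_fderiv_le_of_lipschitz ℝ hC
  have hderiv (t : ℝ) (ht : t ∈ Ioo (0 : ℝ) 1) := c.hasDerivAt_integral hν hφ ht
  have hint : IntervalIntegrable (fun s => ∫ x, inner ℝ (gradient φ x)
      (homothetyVelocity R xbar s x) ∂(movingHomothety ν R xbar s)) volume 0 1 := by
    have hbound := (((hR.norm.mul_const ρ).add hx.norm).const_mul (C : ℝ)).mul_const
      (ν.real univ)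
    rw [intervalIntegrable_iff_integrableOn_Ioo_of_le zero_le_one] at hbound ⊢
    refine hbound.mono' ((aestronglyMeasurable_deriv
      (fun s => ∫ x, φ x ∂(movingHomothety ν R xbar s)) _).congr ?_) ?_
    · filter_upwards [ae_restrict_mem measurableSet_Ioo] with t ht using (hderiv t ht).deriv
    · filter_upwards [ae_restrict_mem measurableSet_Ioo] with t ht
      exact c.norm_integral_gradient_le hν hφ hgrad ht
  have hint' := hint.mono_set (c := t₁) (d := t₂) (by
    rw [uIcc_of_le h12.le, uIcc_of_le zero_le_one]
    exact Icc_subset_Icc ht₁.1 ht₂.2)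
  exact ⟨hint', (intervalIntegral.integral_eq_sub_of_hasDerivAt_of_le h12.le
    ((c.continuousOn_integral hφ.continuous hB).mono (Icc_subset_Icc ht₁.1 ht₂.2))
    (fun t ht => hderiv t (Ioo_subset_Ioo ht₁.1 ht₂.2 ht)) hint').symm⟩

end TangentField

end IsHomothetyPath

/-! ### Energy and the coefficient `K` -/

section Density

variable {d : ℕ} {ν : Measure (EuclideanSpace ℝ (Fin d))} {R : ℝ → ℝ}
  {xbar : ℝ → EuclideanSpace ℝ (Fin d)} {t : ℝ}

theorem lintegral_comp_smul_add {r : ℝ} (hr : 0 < r) (c : EuclideanSpace ℝ (Fin d))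
    {f : EuclideanSpace ℝ (Fin d) → ℝ≥0∞} (hf : Measurable f) :
    ∫⁻ x, f (r • x + c) = ENNReal.ofReal (r ^ d)⁻¹ * ∫⁻ y, f y := by
  rw [← lintegral_map (μ := volume) (f := fun y => f (y + c)) (g := (r • ·)) (by fun_prop)
    (by fun_prop), Measure.map_addHaar_smul _ hr.ne', lintegral_smul_measure,
    lintegral_add_right_eq_self, finrank_euclideanSpace_fin, abs_of_pos (by positivity),
    smul_eq_mul]

theorem movingHomothety_withDensity {f : EuclideanSpace ℝ (Fin d) → ℝ≥0∞} (hf : Measurable f)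
    (hR : 0 < R t) : movingHomothety (volume.withDensity f) R xbar t
      = volume.withDensity fun y =>
          ENNReal.ofReal (R t ^ d)⁻¹ * f ((R t)⁻¹ • (y - xbar t)) := by
  refine Measure.ext_of_lintegral _ fun g hg => ?_
  have hscale := lintegral_comp_smul_add hR (xbar t)
    (f := fun y => f ((R t)⁻¹ • (y - xbar t)) * g y) (by fun_prop)
  simp only [add_sub_cancel_right, inv_smul_smul₀ hR.ne'] at hscale
  rw [movingHomothety, lintegral_map hg (by fun_prop),
    lintegral_withDensity_eq_lintegral_mul _ hf (by fun_prop),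
    lintegral_withDensity_eq_lintegral_mul _ (by fun_prop) hg]
  simp only [Pi.mul_apply, mul_assoc]
  rw [hscale, lintegral_const_mul' _ _ ENNReal.ofReal_ne_top]

theorem densityFunctional_withDensity (q : ℝ) {f : EuclideanSpace ℝ (Fin d) → ℝ≥0∞}
    (hf : Measurable f) : densityFunctional q (volume.withDensity f) = ∫⁻ x, f x ^ q := by
  rw [densityFunctional, if_pos (withDensity_absolutelyContinuous _ _)]
  refine lintegral_congr_ae ?_
  filter_upwards [Measure.rnDeriv_withDensity volume hf] with x hx
  rw [hx]

theorem densityFunctional_two_movingHomothety [SigmaFinite ν]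
    (hν : densityFunctional 2 ν ≠ ⊤) (hR : 0 < R t) :
    densityFunctional 2 (movingHomothety ν R xbar t)
      = ENNReal.ofReal (R t ^ d)⁻¹ * densityFunctional 2 ν := by
  have hac : ν ≪ volume := by
    by_contra hac
    exact hν (if_neg hac)
  have hmeas := ν.measurable_rnDeriv volume
  have hscale := lintegral_comp_smul_add hR (xbar t)
    (f := fun y => ν.rnDeriv volume ((R t)⁻¹ • (y - xbar t)) ^ (2 : ℝ)) (by fun_prop)
  simp only [add_sub_cancel_right, inv_smul_smul₀ hR.ne'] at hscale
  rw [← Measure.withDensity_rnDeriv_eq ν volume hac, movingHomothety_withDensity hmeas hR,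
    densityFunctional_withDensity _ (by fun_prop), densityFunctional_withDensity _ hmeas, hscale]
  simp only [ENNReal.mul_rpow_of_nonneg _ _ zero_le_two]
  rw [lintegral_const_mul' _ _ (by simp), ENNReal.rpow_two, sq, mul_assoc]

end Density

/-- The squared `L²` norm of the flow velocity of `x ↦ R(t) x + x̄(t)` with respect to the image of
a centred probability measure with second moment `m`. -/
noncomputable def homothetyEnergy {E : Type*} [NormedAddCommGroup E] [NormedSpace ℝ E] (m : ℝ)
    (R : ℝ → ℝ) (xbar : ℝ → E) (t : ℝ) : ℝ :=
  deriv R t ^ 2 * m + ‖deriv xbar t‖ ^ 2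

section Energy

variable {E : Type*} [NormedAddCommGroup E] [NormedSpace ℝ E] {m : ℝ} {R : ℝ → ℝ} {xbar : ℝ → E}
  {t : ℝ}

theorem homothetyEnergy_nonneg (hm : 0 ≤ m) : 0 ≤ homothetyEnergy m R xbar t := by
  unfold homothetyEnergy
  positivity

theorem IsHomothetyPath.continuousOn_homothetyEnergy (c : IsHomothetyPath R xbar) :
    ContinuousOn (homothetyEnergy m R xbar) (Ioo 0 1) :=
  ((c.contDiffOn_deriv_scale.continuousOn.pow 2).mul continuousOn_const).add
    (c.contDiffOn_deriv_center.continuousOn.norm.pow 2)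

end Energy

theorem integral_norm_smul_add_sq {E : Type*} [NormedAddCommGroup E] [InnerProductSpace ℝ E]
    [CompleteSpace E] [MeasurableSpace E] {ν : Measure E} [IsProbabilityMeasure ν]
    (hν : MemLp id 2 ν) (hmean : ∫ x, x ∂ν = 0) (c : ℝ) (e : E) :
    ∫ x, ‖c • x + e‖ ^ 2 ∂ν = c ^ 2 * ∫ x, ‖x‖ ^ 2 ∂ν + ‖e‖ ^ 2 := by
  have hid : Integrable (fun x => x) ν := hν.integrable one_le_two
  have hsq : Integrable (fun x => ‖x‖ ^ 2) ν := hν.integrable_norm_pow two_ne_zero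
  have hinner : Integrable (fun x => (inner ℝ e x : ℝ)) ν := hid.const_inner e
  have hexpand (x : E) :
      ‖c • x + e‖ ^ 2 = c ^ 2 * ‖x‖ ^ 2 + (2 * c * inner ℝ e x + ‖e‖ ^ 2) := by
    rw [norm_add_sq_real, norm_smul, mul_pow, Real.norm_eq_abs, sq_abs, real_inner_smul_left,
      real_inner_comm]
    ring
  have hrest : Integrable (fun x => 2 * c * inner ℝ e x + ‖e‖ ^ 2) ν :=
    (hinner.const_mul _).add (integrable_const _)
  simp only [hexpand]
  rw [integral_add (hsq.const_mul _) hrest,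
    integral_add (hinner.const_mul _) (integrable_const _), integral_const_mul, integral_const_mul,
    integral_inner hid, hmean, inner_zero_right]
  simp

theorem ofReal_inv_mul_rpow_eq_ofReal_iff {r F K V : ℝ} (hr : 0 < r) (hF : 0 < F) (hK : 0 < K)
    (hV : 0 ≤ V) :
    ENNReal.ofReal r⁻¹ * ENNReal.ofReal F * ENNReal.ofReal V ^ (-(1 / 2) : ℝ) = ENNReal.ofReal K ↔
      r ^ 2 * V = (F / K) ^ 2 := by
  rw [← ENNReal.ofReal_mul (by positivity)]
  rcases hV.eq_or_lt with rfl | hV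
  · rw [ENNReal.ofReal_zero, ENNReal.zero_rpow_of_neg (by norm_num),
      ENNReal.mul_top (by positivity), mul_zero]
    exact iff_of_false ENNReal.ofReal_ne_top.symm (by positivity)
  · rw [ENNReal.ofReal_rpow_of_pos hV, ← ENNReal.ofReal_mul (by positivity),
      ENNReal.ofReal_eq_ofReal_iff (by positivity) hK.le, Real.rpow_neg hV.le,
      ← Real.sqrt_eq_rpow, ← div_eq_mul_inv, inv_mul_eq_div, div_div, div_eq_iff (by positivity),
      ← sq_eq_sq₀ hF.le (by positivity), mul_pow, mul_pow, Real.sq_sqrt hV.le, div_pow,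
      eq_div_iff (by positivity)]
    exact ⟨fun h => by linarith, fun h => by linarith⟩

section CoefficientK

variable {d : ℕ} {ν : Measure (EuclideanSpace ℝ (Fin d))} [IsProbabilityMeasure ν] {R : ℝ → ℝ}
  {xbar : ℝ → EuclideanSpace ℝ (Fin d)} {t F K : ℝ}
  {w : ℝ → EuclideanSpace ℝ (Fin d) → EuclideanSpace ℝ (Fin d)}

theorem kineticV_congr {μ μ' : ℝ → Measure (EuclideanSpace ℝ (Fin d))}
    {v v' : ℝ → EuclideanSpace ℝ (Fin d) → EuclideanSpace ℝ (Fin d)} (hμ : μ t = μ' t)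
    (hv : v t =ᵐ[μ t] v' t) : kineticV μ v t = kineticV μ' v' t := by
  rw [kineticV, kineticV, ← hμ]
  exact lintegral_congr_ae (hv.fun_comp (‖·‖ₑ ^ 2))

theorem kineticV_movingHomothety (hν : MemLp id 2 ν) (hmean : ∫ x, x ∂ν = 0) (hR : R t ≠ 0)
    (hw : w t =ᵐ[movingHomothety ν R xbar t] homothetyVelocity R xbar t) :
    kineticV (movingHomothety ν R xbar) w t
      = ENNReal.ofReal (homothetyEnergy (∫ x, ‖x‖ ^ 2 ∂ν) R xbar t) := by
  have hmem : MemLp (fun x => deriv R t • x + deriv xbar t) 2 ν :=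
    (hν.const_smul (deriv R t)).add (memLp_const _)
  have hnorm (x : EuclideanSpace ℝ (Fin d)) : ‖deriv R t • x + deriv xbar t‖ₑ ^ 2
      = ENNReal.ofReal (‖deriv R t • x + deriv xbar t‖ ^ 2) := by
    rw [ENNReal.ofReal_pow (norm_nonneg _), ofReal_norm]
  have hcont := continuous_homothetyVelocity (R := R) (xbar := xbar) t
  rw [kineticV_congr rfl hw, kineticV, movingHomothety, lintegral_map (by fun_prop) (by fun_prop)]
  simp only [homothetyVelocity_smul_add hR, hnorm]
  rw [← ofReal_integral_eq_lintegral_ofReal (hmem.integrable_norm_pow two_ne_zero)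
    (.of_forall fun x => by positivity), integral_norm_smul_add_sq hν hmean, homothetyEnergy]

theorem coefficientK_movingHomothety_eq_iff (hν : MemLp id 2 ν) (hmean : ∫ x, x ∂ν = 0)
    (hF : 0 < F) (hνF : densityFunctional 2 ν = ENNReal.ofReal F) (hR : 0 < R t)
    (hw : w t =ᵐ[movingHomothety ν R xbar t] homothetyVelocity R xbar t) (hK : 0 < K) :
    coefficientK (movingHomothety ν R xbar) w t = ENNReal.ofReal K ↔
      R t ^ (2 * d) * homothetyEnergy (∫ x, ‖x‖ ^ 2 ∂ν) R xbar t = (F / K) ^ 2 := by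
  rw [coefficientK, densityFunctional_two_movingHomothety (hνF ▸ ENNReal.ofReal_ne_top) hR, hνF,
    kineticV_movingHomothety hν hmean hR.ne' hw, ofReal_inv_mul_rpow_eq_ofReal_iff (by positivity)
      hF hK (homothetyEnergy_nonneg (by positivity)), ← pow_mul, mul_comm d]

theorem IsHomothetyPath.hasConstantK_iff (c : IsHomothetyPath R xbar) {ρ : ℝ}
    (hν : ∀ᵐ x ∂ν, ‖x‖ ≤ ρ) (hmean : ∫ x, x ∂ν = 0) (hF : 0 < F)
    (hνF : densityFunctional 2 ν = ENNReal.ofReal F) :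
    HasConstantK (movingHomothety ν R xbar) K ↔ 0 < K ∧
      IsTangentField (movingHomothety ν R xbar) (homothetyVelocity R xbar) ∧
        ∀ t ∈ Ioo (0 : ℝ) 1,
          R t ^ (2 * d) * homothetyEnergy (∫ x, ‖x‖ ^ 2 ∂ν) R xbar t = (F / K) ^ 2 := by
  have hid := memLp_of_continuous_of_ae_norm_le hν continuous_id 2
  refine and_congr_right fun hK => ⟨?_, fun ⟨htangent, henergy⟩ => ⟨_, htangent, ?_⟩⟩
  · rintro ⟨w, hw, hwK⟩
    refine ⟨c.isTangentField_of_exists hν hw.1, ?_⟩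
    refine Measure.eqOn_open_of_ae_eq (μ := volume) ?_ isOpen_Ioo
      ((c.scale_contDiffOn.continuousOn.pow _).mul c.continuousOn_homothetyEnergy)
      continuousOn_const
    filter_upwards [ae_restrict_of_ae_restrict_of_subset Ioo_subset_Icc_self hwK,
      ae_restrict_of_ae_restrict_of_subset Ioo_subset_Icc_self (c.ae_eq_homothetyVelocity hν hw),
      ae_restrict_mem measurableSet_Ioo] with t hKt hwt ht
    exact (coefficientK_movingHomothety_eq_iff hid hmean hF hνF (c.scale_pos t ht) hwt hK).1 hKt
  · rw [← Measure.restrict_congr_set Ioo_ae_eq_Icc]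
    filter_upwards [ae_restrict_mem measurableSet_Ioo] with t ht
    exact (coefficientK_movingHomothety_eq_iff hid hmean hF hνF (c.scale_pos t ht) .rfl hK).2
      (henergy t ht)

end CoefficientK

/-! ### The equation for the scale -/

namespace IsHomothetyPath

variable {E : Type*} [NormedAddCommGroup E] [InnerProductSpace ℝ E] {R : ℝ → ℝ} {xbar : ℝ → E}
  {m C t : ℝ} {n : ℕ}

theorem hasDerivAt_homothetyEnergy (c : IsHomothetyPath R xbar) (ht : t ∈ Ioo (0 : ℝ) 1)
    (hx : deriv (deriv xbar) t = 0) :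
    HasDerivAt (homothetyEnergy m R xbar) (2 * m * deriv R t * deriv (deriv R) t) t := by
  have hcenter := (c.hasDerivAt_deriv_center ht).norm_sq
  rw [hx, inner_zero_right, mul_zero] at hcenter
  refine ((((c.hasDerivAt_deriv_scale ht).pow 2).mul_const m).add hcenter).congr_deriv ?_
  push_cast
  ring

theorem hasDerivAt_scale_pow_mul_homothetyEnergy (c : IsHomothetyPath R xbar)
    (ht : t ∈ Ioo (0 : ℝ) 1) (hx : deriv (deriv xbar) t = 0) :
    HasDerivAt (fun s => R s ^ (2 * n) * homothetyEnergy m R xbar s)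
      (2 * R t ^ (2 * n) * (deriv R t / R t) *
        (n * homothetyEnergy m R xbar t + m * R t * deriv (deriv R) t)) t := by
  have hR := (c.scale_pos t ht).ne'
  refine (((c.hasDerivAt_scale ht).pow (2 * n)).mul
    (c.hasDerivAt_homothetyEnergy ht hx)).congr_deriv ?_
  rcases n with _ | n
  · simp only [mul_zero, Pi.pow_apply, pow_zero, Nat.cast_zero, zero_mul]
    field_simp
    ring
  · rw [Nat.mul_succ, Nat.add_sub_assoc one_le_two, Pi.pow_apply]
    push_cast
    field_simp
    ring

theorem strictAntiOn_deriv_scale (c : IsHomothetyPath R xbar)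
    (hconcave : StrictConcaveOn ℝ (Icc 0 1) R) : StrictAntiOn (deriv R) (Ioo 0 1) :=
  (hconcave.subset Ioo_subset_Icc_self (convex_Ioo 0 1)).strictAntiOn_deriv fun _ ht =>
    (c.hasDerivAt_scale ht).differentiableAt

/-- `R'` is strictly decreasing, hence vanishes at most once, and the second factor of
`hasDerivAt_scale_pow_mul_homothetyEnergy` vanishes everywhere by continuity. -/
theorem scale_ode_of_strictConcaveOn (c : IsHomothetyPath R xbar)
    (hx : ∀ t ∈ Ioo (0 : ℝ) 1, deriv (deriv xbar) t = 0)
    (hC : ∀ t ∈ Ioo (0 : ℝ) 1, R t ^ (2 * n) * homothetyEnergy m R xbar t = C)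
    (hconcave : StrictConcaveOn ℝ (Icc 0 1) R) :
    ∀ t ∈ Ioo (0 : ℝ) 1, n * homothetyEnergy m R xbar t + m * R t * deriv (deriv R) t = 0 := by
  have hprod (t : ℝ) (ht : t ∈ Ioo (0 : ℝ) 1) : deriv R t = 0 ∨
      n * homothetyEnergy m R xbar t + m * R t * deriv (deriv R) t = 0 := by
    have hconst : HasDerivAt (fun s => R s ^ (2 * n) * homothetyEnergy m R xbar s) 0 t :=
      (hasDerivAt_const t C).congr_of_eventuallyEq
        (mem_of_superset (isOpen_Ioo.mem_nhds ht) hC)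
    simpa [(c.scale_pos t ht).ne'] using
      (c.hasDerivAt_scale_pow_mul_homothetyEnergy ht (hx t ht)).unique hconst
  have hcritical : {t | t ∈ Ioo (0 : ℝ) 1 ∧ deriv R t = 0}.Subsingleton := fun s hs t ht =>
    (c.strictAntiOn_deriv_scale hconcave).injOn hs.1 ht.1 (hs.2.trans ht.2.symm)
  refine Measure.eqOn_open_of_ae_eq (μ := volume) ?_ isOpen_Ioo ?_ continuousOn_const
  · filter_upwards [ae_restrict_mem measurableSet_Ioo,
      ae_restrict_of_ae (compl_mem_ae_iff.2 (hcritical.measure_zero volume))] with t ht hne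
    exact (hprod t ht).resolve_left fun h => hne ⟨ht, h⟩
  · exact (continuousOn_const.mul c.continuousOn_homothetyEnergy).add
      ((continuousOn_const.mul c.scale_contDiffOn.continuousOn).mul
        (c.contDiffOn_deriv_scale.continuousOn_deriv_of_isOpen isOpen_Ioo le_rfl))

theorem strictConcaveOn_scale_of_ode (c : IsHomothetyPath R xbar) (hn : 0 < n) (hm : 0 < m)
    (hpos : ∀ t ∈ Ioo (0 : ℝ) 1, 0 < homothetyEnergy m R xbar t)
    (hode : ∀ t ∈ Ioo (0 : ℝ) 1,
      n * homothetyEnergy m R xbar t + m * R t * deriv (deriv R) t = 0) :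
    StrictConcaveOn ℝ (Icc 0 1) R := by
  refine strictConcaveOn_of_deriv2_neg (convex_Icc 0 1) c.scale_continuousOn fun t ht => ?_
  rw [interior_Icc] at ht
  have hmul : 0 < n * homothetyEnergy m R xbar t := mul_pos (mod_cast hn) (hpos t ht)
  have hneg : m * R t * deriv (deriv R) t < 0 := by linarith [hode t ht]
  exact neg_of_mul_neg_right hneg (mul_pos hm (c.scale_pos t ht)).le

theorem scale_ode_iff_strictConcaveOn (c : IsHomothetyPath R xbar) (hn : 0 < n) (hm : 0 < m)
    (hx : ∀ t ∈ Ioo (0 : ℝ) 1, deriv (deriv xbar) t = 0) (hC_pos : 0 < C)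
    (hC : ∀ t ∈ Ioo (0 : ℝ) 1, R t ^ (2 * n) * homothetyEnergy m R xbar t = C) :
    (∀ t ∈ Ioo (0 : ℝ) 1,
        n * homothetyEnergy m R xbar t + m * R t * deriv (deriv R) t = 0) ↔
      StrictConcaveOn ℝ (Icc 0 1) R :=
  ⟨c.strictConcaveOn_scale_of_ode hn hm fun t ht => pos_of_mul_pos_right (hC_pos.trans_eq
    (hC t ht).symm) (pow_pos (c.scale_pos t ht) _).le, c.scale_ode_of_strictConcaveOn hx hC⟩

theorem exists_deriv_scale_ne_zero (c : IsHomothetyPath R xbar)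
    (hconcave : StrictConcaveOn ℝ (Icc 0 1) R) : ∃ t ∈ Ioo (0 : ℝ) 1, deriv R t ≠ 0 := by
  by_contra! hzero
  have hlow : (1 / 3 : ℝ) ∈ Ioo (0 : ℝ) 1 := by norm_num
  have hhigh : (2 / 3 : ℝ) ∈ Ioo (0 : ℝ) 1 := by norm_num
  have hlt := c.strictAntiOn_deriv_scale hconcave hlow hhigh (by norm_num)
  rw [hzero _ hlow, hzero _ hhigh] at hlt
  exact hlt.false

theorem pos_of_scale_pow_mul_homothetyEnergy_eq (c : IsHomothetyPath R xbar) (hm : 0 < m)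
    (hC : ∀ t ∈ Ioo (0 : ℝ) 1, R t ^ (2 * n) * homothetyEnergy m R xbar t = C)
    (hconcave : StrictConcaveOn ℝ (Icc 0 1) R) : 0 < C := by
  obtain ⟨t, ht, hne⟩ := c.exists_deriv_scale_ne_zero hconcave
  have hR := c.scale_pos t ht
  rw [← hC t ht, homothetyEnergy]
  positivity

end IsHomothetyPath

/-! ### Parabolic profiles -/

/-- The Lebesgue density at time `t` of the image under `x ↦ R(t) x + x̄(t)` of the measure with
density `f`. -/
noncomputable def homothetyDensity {d : ℕ} (f : EuclideanSpace ℝ (Fin d) → ℝ) (R : ℝ → ℝ)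
    (xbar : ℝ → EuclideanSpace ℝ (Fin d)) (t : ℝ) (y : EuclideanSpace ℝ (Fin d)) : ℝ :=
  (R t ^ d)⁻¹ * f ((R t)⁻¹ • (y - xbar t))

section HomothetyDensity

variable {d : ℕ} {f : EuclideanSpace ℝ (Fin d) → ℝ} {R : ℝ → ℝ}
  {xbar : ℝ → EuclideanSpace ℝ (Fin d)} {t : ℝ}

theorem homothetyDensity_nonneg (hf : ∀ x, 0 ≤ f x) (hR : 0 < R t)
    (y : EuclideanSpace ℝ (Fin d)) : 0 ≤ homothetyDensity f R xbar t y :=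
  mul_nonneg (by positivity) (hf _)

theorem homothetyDensity_pos_iff (hR : 0 < R t) {y : EuclideanSpace ℝ (Fin d)} :
    0 < homothetyDensity f R xbar t y ↔ 0 < f ((R t)⁻¹ • (y - xbar t)) :=
  mul_pos_iff_of_pos_left (by positivity)

theorem continuous_homothetyDensity (hf : Continuous f) :
    Continuous (homothetyDensity f R xbar t) := by
  unfold homothetyDensity
  fun_prop

theorem movingHomothety_withDensity_ofReal (hf : Measurable f) (hR : 0 < R t) :
    movingHomothety (volume.withDensity fun x => ENNReal.ofReal (f x)) R xbar t
      = volume.withDensity fun y => ENNReal.ofReal (homothetyDensity f R xbar t y) := by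
  simp_rw [movingHomothety_withDensity hf.ennreal_ofReal hR, homothetyDensity,
    ENNReal.ofReal_mul (inv_nonneg.2 (pow_nonneg hR.le d))]

theorem IsHomothetyPath.continuousOn_homothetyDensity (c : IsHomothetyPath R xbar)
    (hf : Continuous f) (s : Set (EuclideanSpace ℝ (Fin d))) :
    ContinuousOn (fun p : ℝ × EuclideanSpace ℝ (Fin d) => homothetyDensity f R xbar p.1 p.2)
      (Ioo 0 1 ×ˢ s) := by
  have hscale : ContinuousOn (fun p : ℝ × EuclideanSpace ℝ (Fin d) => R p.1) (Ioo 0 1 ×ˢ s) :=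
    c.scale_contDiffOn.continuousOn.comp continuousOn_fst fun p hp => hp.1
  have hcenter : ContinuousOn (fun p : ℝ × EuclideanSpace ℝ (Fin d) => xbar p.1)
      (Ioo 0 1 ×ˢ s) :=
    c.center_contDiffOn.continuousOn.comp continuousOn_fst fun p hp => hp.1
  have hne (p) (hp : p ∈ Ioo (0 : ℝ) 1 ×ˢ s) : R p.1 ≠ 0 := (c.scale_pos p.1 hp.1).ne'
  exact ((hscale.pow d).inv₀ fun p hp => pow_ne_zero _ (hne p hp)).mul
    (hf.comp_continuousOn ((hscale.inv₀ hne).smul (continuousOn_snd.sub hcenter)))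

end HomothetyDensity

theorem ae_withDensity_ofReal_iff {α : Type*} [MeasurableSpace α] {μ : Measure α} {f : α → ℝ}
    (hf : Measurable f) {p : α → Prop} :
    (∀ᵐ x ∂μ.withDensity fun x => ENNReal.ofReal (f x), p x) ↔ ∀ᵐ x ∂μ, 0 < f x → p x := by
  simp only [ae_withDensity_iff hf.ennreal_ofReal, ne_eq, ENNReal.ofReal_eq_zero, not_le]

/-- The parabolic profile `A [(ρ² - |x|²) ∨ 0]`. -/
def parabolicDensity {E : Type*} [Norm E] (A ρ : ℝ) (x : E) : ℝ :=
  A * max (ρ ^ 2 - ‖x‖ ^ 2) 0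

theorem continuous_parabolicDensity {E : Type*} [SeminormedAddCommGroup E] (A ρ : ℝ) :
    Continuous (parabolicDensity (E := E) A ρ) := by
  unfold parabolicDensity
  fun_prop

theorem parabolicDensity_eq_of_norm_le {E : Type*} [SeminormedAddCommGroup E] {A ρ : ℝ} {x : E}
    (hx : ‖x‖ ≤ ρ) : parabolicDensity A ρ x = A * (ρ ^ 2 - ‖x‖ ^ 2) := by
  rw [parabolicDensity, max_eq_left (sub_nonneg.2 (pow_le_pow_left₀ (norm_nonneg x) hx 2))]

/-- The probability measures with density `A [(ρ² - |x|²) ∨ 0]`. The normalization determines `A`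
as a function of `ρ` and the dimension. -/
structure IsParabolicProfile {d : ℕ} (A ρ : ℝ) (ν : Measure (EuclideanSpace ℝ (Fin d))) :
    Prop where
  radius_pos : 0 < ρ
  isProbabilityMeasure : IsProbabilityMeasure ν
  eq_withDensity : ν = volume.withDensity fun x => ENNReal.ofReal (parabolicDensity A ρ x)

theorem integral_Ioi_pow_mul_max_sq_sub_sq {ρ : ℝ} (hρ : 0 ≤ ρ) (k : ℕ) :
    ∫ y in Ioi (0 : ℝ), y ^ k * max (ρ ^ 2 - y ^ 2) 0
      = 2 * ρ ^ (k + 3) / ((k + 1) * (k + 3)) := by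
  have hsupport : ∫ y in Ioi (0 : ℝ), y ^ k * max (ρ ^ 2 - y ^ 2) 0
      = ∫ y in Ioc 0 ρ, y ^ k * max (ρ ^ 2 - y ^ 2) 0 := by
    refine setIntegral_eq_of_subset_of_forall_sdiff_eq_zero measurableSet_Ioi
      Ioc_subset_Ioi_self fun y hy => ?_
    have hlt : ρ < y := not_le.1 fun hle => hy.2 ⟨hy.1, hle⟩
    rw [max_eq_right (by nlinarith), mul_zero]
  have hpoly : ∫ y in (0 : ℝ)..ρ, y ^ k * max (ρ ^ 2 - y ^ 2) 0
      = ∫ y in (0 : ℝ)..ρ, (ρ ^ 2 * y ^ k - y ^ (k + 2)) := by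
    refine intervalIntegral.integral_congr fun y hy => ?_
    rw [uIcc_of_le hρ] at hy
    rw [max_eq_left (sub_nonneg.2 (pow_le_pow_left₀ hy.1 hy.2 2))]
    ring
  rw [hsupport, ← intervalIntegral.integral_of_le hρ, hpoly, intervalIntegral.integral_sub
    (Continuous.intervalIntegrable (by fun_prop) _ _)
    (Continuous.intervalIntegrable (by fun_prop) _ _), intervalIntegral.integral_const_mul,
    integral_pow, integral_pow]
  push_cast
  rw [zero_pow k.succ_ne_zero, zero_pow (k + 2).succ_ne_zero]
  have hk : (k : ℝ) + 2 + 1 = k + 3 := by ring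
  rw [hk]
  field_simp
  ring

namespace IsParabolicProfile

variable {d : ℕ} {A ρ : ℝ} {ν : Measure (EuclideanSpace ℝ (Fin d))}

theorem amplitude_pos (h : IsParabolicProfile A ρ ν) : 0 < A := by
  by_contra! hA
  have hzero (x : EuclideanSpace ℝ (Fin d)) : ENNReal.ofReal (parabolicDensity A ρ x) = 0 :=
    ENNReal.ofReal_of_nonpos (mul_nonpos_of_nonpos_of_nonneg hA (le_max_right _ _))
  have hν : ν = 0 := by
    rw [h.eq_withDensity]
    simp only [hzero]
    exact withDensity_zero
  have := h.isProbabilityMeasure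
  exact NeZero.ne ν hν

theorem density_nonneg (h : IsParabolicProfile A ρ ν) (x : EuclideanSpace ℝ (Fin d)) :
    0 ≤ parabolicDensity A ρ x :=
  mul_nonneg h.amplitude_pos.le (le_max_right _ _)

theorem density_pos_iff (h : IsParabolicProfile A ρ ν) {x : EuclideanSpace ℝ (Fin d)} :
    0 < parabolicDensity A ρ x ↔ ‖x‖ < ρ := by
  rw [parabolicDensity, mul_pos_iff_of_pos_left h.amplitude_pos, lt_max_iff,
    or_iff_left (lt_irrefl _), sub_pos, sq_lt_sq₀ (norm_nonneg _) h.radius_pos.le]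

theorem ae_norm_le (h : IsParabolicProfile A ρ ν) : ∀ᵐ x ∂ν, ‖x‖ ≤ ρ := by
  rw [h.eq_withDensity, ae_withDensity_ofReal_iff (continuous_parabolicDensity A ρ).measurable]
  exact .of_forall fun x hx => (h.density_pos_iff.1 hx).le

theorem integrable_of_continuous (h : IsParabolicProfile A ρ ν) {F : Type*}
    [NormedAddCommGroup F] {f : EuclideanSpace ℝ (Fin d) → F} (hf : Continuous f) :
    Integrable f ν :=
  have := h.isProbabilityMeasure
  memLp_one_iff_integrable.1 (memLp_of_continuous_of_ae_norm_le h.ae_norm_le hf 1)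

theorem integral_eq (h : IsParabolicProfile A ρ ν) {F : Type*} [NormedAddCommGroup F]
    [NormedSpace ℝ F] (f : EuclideanSpace ℝ (Fin d) → F) :
    ∫ x, f x ∂ν = ∫ x, parabolicDensity A ρ x • f x := by
  conv_lhs => rw [h.eq_withDensity]
  rw [integral_withDensity_eq_integral_toReal_smul
    (continuous_parabolicDensity A ρ).measurable.ennreal_ofReal
    (.of_forall fun _ => ENNReal.ofReal_lt_top)]
  simp only [ENNReal.toReal_ofReal (h.density_nonneg _)]

theorem integral_norm_pow (h : IsParabolicProfile A ρ ν) (hd : 0 < d) (k : ℕ) :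
    ∫ x, ‖x‖ ^ k ∂ν = d * (volume.real (Metric.ball (0 : EuclideanSpace ℝ (Fin d)) 1) *
      (A * (2 * ρ ^ (d + k + 2) / ((d + k) * (d + k + 2))))) := by
  have : Nonempty (Fin d) := ⟨⟨0, hd⟩⟩
  obtain ⟨n, rfl⟩ := Nat.exists_eq_add_of_lt hd
  have hradial (y : ℝ) : y ^ (0 + n + 1 - 1) • (A * max (ρ ^ 2 - y ^ 2) 0 * y ^ k)
      = A * (y ^ (n + k) * max (ρ ^ 2 - y ^ 2) 0) := by
    rw [smul_eq_mul, Nat.add_sub_cancel, zero_add, pow_add]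
    ring
  rw [h.integral_eq]
  simp only [parabolicDensity, smul_eq_mul]
  rw [integral_fun_norm_addHaar volume fun y => A * max (ρ ^ 2 - y ^ 2) 0 * y ^ k,
    finrank_euclideanSpace_fin]
  simp only [hradial]
  rw [integral_const_mul, integral_Ioi_pow_mul_max_sq_sub_sq h.radius_pos.le, nsmul_eq_mul,
    smul_eq_mul]
  push_cast
  ring_nf

theorem integral_norm_sq (h : IsParabolicProfile A ρ ν) (hd : 0 < d) :
    ∫ x, ‖x‖ ^ 2 ∂ν = d * ρ ^ 2 / (d + 4) := by
  have := h.isProbabilityMeasure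
  have hmass := h.integral_norm_pow hd 0
  simp only [pow_zero, integral_const, probReal_univ, smul_eq_mul, mul_one, Nat.cast_zero,
    add_zero] at hmass
  have hd₀ : (d : ℝ) ≠ 0 := by positivity
  have hd₄ : (d : ℝ) + 2 + 2 = d + 4 := by ring
  rw [h.integral_norm_pow hd 2]
  push_cast
  rw [hd₄]
  field_simp at hmass ⊢
  rw [pow_add _ _ 2]
  linear_combination -ρ ^ 2 * hmass

theorem integral_norm_sq_pos (h : IsParabolicProfile A ρ ν) (hd : 0 < d) :
    0 < ∫ x, ‖x‖ ^ 2 ∂ν := by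
  have hρ := h.radius_pos
  rw [h.integral_norm_sq hd]
  positivity

theorem integral_id (h : IsParabolicProfile A ρ ν) : ∫ x, x ∂ν = 0 := by
  rw [h.integral_eq]
  have hodd := integral_neg_eq_self
    (fun x : EuclideanSpace ℝ (Fin d) => parabolicDensity A ρ x • x) volume
  simp only [parabolicDensity, norm_neg, smul_neg, integral_neg] at hodd
  have : IsAddTorsionFree (EuclideanSpace ℝ (Fin d)) := .of_isTorsionFree ℝ _
  exact self_eq_neg.1 hodd.symm

theorem integral_density (h : IsParabolicProfile A ρ ν) (hd : 0 < d) :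
    ∫ x, parabolicDensity A ρ x ∂ν = 4 * A * ρ ^ 2 / (d + 4) := by
  have := h.isProbabilityMeasure
  have hpoly : parabolicDensity A ρ =ᵐ[ν] fun x => A * (ρ ^ 2 - ‖x‖ ^ 2) :=
    h.ae_norm_le.mono fun x hx => parabolicDensity_eq_of_norm_le hx
  rw [integral_congr_ae hpoly, integral_const_mul, integral_sub (integrable_const _)
    (h.integrable_of_continuous (by fun_prop)), h.integral_norm_sq hd, integral_const,
    probReal_univ, one_smul]
  field_simp
  ring

theorem densityFunctional_two (h : IsParabolicProfile A ρ ν) (hd : 0 < d) :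
    densityFunctional 2 ν = ENNReal.ofReal (4 * A * ρ ^ 2 / (d + 4)) := by
  have hmeas := (continuous_parabolicDensity (E := EuclideanSpace ℝ (Fin d)) A ρ).measurable
  have hint := h.integrable_of_continuous (continuous_parabolicDensity A ρ)
  rw [← h.integral_density hd, ofReal_integral_eq_lintegral_ofReal hint
    (.of_forall h.density_nonneg), h.eq_withDensity,
    densityFunctional_withDensity _ hmeas.ennreal_ofReal,
    lintegral_withDensity_eq_lintegral_mul _ hmeas.ennreal_ofReal hmeas.ennreal_ofReal]
  simp only [ENNReal.rpow_two, sq, Pi.mul_apply]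

end IsParabolicProfile

/-! ### The momentum equation on the moving ball -/

theorem eqOn_of_ae_ae_eq {X Y F : Type*} [TopologicalSpace X] [MeasurableSpace X]
    [OpensMeasurableSpace X] [TopologicalSpace Y] [MeasurableSpace Y] [OpensMeasurableSpace Y]
    [TopologicalSpace F] [T2Space F] {μ : Measure X} [μ.IsOpenPosMeasure] {ν : Measure Y}
    [ν.IsOpenPosMeasure] {U : Set (X × Y)} (hU : IsOpen U) {f g : X × Y → F}
    (hf : ContinuousOn f U) (hg : ContinuousOn g U)
    (hfg : ∀ᵐ x ∂μ, ∀ᵐ y ∂ν, (x, y) ∈ U → f (x, y) = g (x, y)) : EqOn f g U := by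
  have hslice : ∀ᵐ x ∂μ, ∀ y, (x, y) ∈ U → f (x, y) = g (x, y) := by
    filter_upwards [hfg] with x hx
    have hx_open : IsOpen {y | (x, y) ∈ U} := hU.preimage (by fun_prop)
    exact Measure.eqOn_open_of_ae_eq ((ae_restrict_iff' hx_open.measurableSet).2 hx) hx_open
      (hf.comp (by fun_prop) fun y hy => hy) (hg.comp (by fun_prop) fun y hy => hy)
  rintro ⟨x, y⟩ hxy
  have hy_open : IsOpen {x | (x, y) ∈ U} := hU.preimage (by fun_prop)
  exact Measure.eqOn_open_of_ae_eq (f := fun x => f (x, y)) (g := fun x => g (x, y))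
    ((ae_restrict_iff' hy_open.measurableSet).2 (hslice.mono fun x hx => hx y)) hy_open
    (hf.comp (by fun_prop) fun x hx => hx) (hg.comp (by fun_prop) fun x hx => hx) hxy

section DensityMeasure

variable {d : ℕ} {Ω : Set (EuclideanSpace ℝ (Fin d))} {f g : EuclideanSpace ℝ (Fin d) → ℝ}

theorem withDensity_ofReal_eq_densityMeasure (hΩ : MeasurableSet Ω)
    (hf : volume.withDensity (fun x => ENNReal.ofReal (f x)) Ωᶜ = 0) :
    volume.withDensity (fun x => ENNReal.ofReal (f x)) = densityMeasure Ω f := by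
  rw [densityMeasure, ← restrict_withDensity hΩ, Measure.restrict_eq_self_of_ae_mem hf]

theorem setOf_pos_subset_interior (hΩ : IsClosed Ω) (hf : Continuous f)
    (hfΩ : volume.withDensity (fun x => ENNReal.ofReal (f x)) Ωᶜ = 0) :
    {x | 0 < f x} ⊆ interior Ω := by
  have hopen : IsOpen {x | 0 < f x} := isOpen_lt continuous_const hf
  refine interior_maximal (fun x hx => not_not.1 fun hxΩ => ?_) hopen
  refine ((hopen.inter hΩ.isOpen_compl).measure_pos volume ⟨x, hx, hxΩ⟩).ne'
    (measure_mono_null ?_ ((ae_withDensity_ofReal_iff hf.measurable (p := (· ∈ Ω))).1 hfΩ))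
  exact fun y hy hyΩ => hy.2 (hyΩ hy.1)

theorem eqOn_interior_of_densityMeasure_eq [IsFiniteMeasure (densityMeasure Ω f)]
    (hΩ : MeasurableSet Ω) (hf : ContinuousOn f Ω) (hf_nonneg : ∀ x ∈ Ω, 0 ≤ f x)
    (hg : ContinuousOn g Ω) (hg_nonneg : ∀ x ∈ Ω, 0 ≤ g x)
    (hfg : densityMeasure Ω f = densityMeasure Ω g) : EqOn f g (interior Ω) := by
  have hfinite : ∫⁻ x in Ω, ENNReal.ofReal (f x) ≠ ⊤ := by
    simpa only [densityMeasure, withDensity_apply _ MeasurableSet.univ, Measure.restrict_univ]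
      using measure_ne_top (densityMeasure Ω f) univ
  have hae := (withDensity_eq_iff (hf.aemeasurable hΩ).ennreal_ofReal
    (hg.aemeasurable hΩ).ennreal_ofReal hfinite).1 hfg
  refine Measure.eqOn_open_of_ae_eq (μ := volume) ?_ isOpen_interior (hf.mono interior_subset)
    (hg.mono interior_subset)
  refine ae_restrict_of_ae_restrict_of_subset interior_subset ?_
  filter_upwards [hae, ae_restrict_mem hΩ] with x hx hxΩ
  exact (ENNReal.ofReal_eq_ofReal_iff (hf_nonneg x hxΩ) (hg_nonneg x hxΩ)).1 hx

end DensityMeasure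

/-- The space-time region swept out by the images of the ball `B(0, ρ)`, the positivity set of the
image of a parabolic profile. -/
def movingBall {E : Type*} [NormedAddCommGroup E] (ρ : ℝ) (R : ℝ → ℝ) (xbar : ℝ → E) :
    Set (ℝ × E) :=
  {p | p.1 ∈ Ioo (0 : ℝ) 1 ∧ ‖p.2 - xbar p.1‖ < R p.1 * ρ}

section MovingBall

variable {E : Type*} [NormedAddCommGroup E] [NormedSpace ℝ E] {R : ℝ → ℝ} {xbar : ℝ → E} {ρ t : ℝ}

theorem fderiv_homothetyVelocity_apply (x y : E) :
    fderiv ℝ (homothetyVelocity R xbar t) x y = (deriv R t / R t) • y := by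
  have hderiv : HasFDerivAt (homothetyVelocity R xbar t)
      ((deriv R t / R t) • ContinuousLinearMap.id ℝ E) x :=
    (((hasFDerivAt_id x).sub_const (xbar t)).const_smul (deriv R t / R t)).add_const _
  rw [hderiv.fderiv, smul_apply, ContinuousLinearMap.id_apply]

namespace IsHomothetyPath

theorem isOpen_movingBall (c : IsHomothetyPath R xbar) : IsOpen (movingBall ρ R xbar) := by
  have hscale : ContinuousOn (fun p : ℝ × E => R p.1) (Ioo 0 1 ×ˢ univ) :=
    c.scale_contDiffOn.continuousOn.comp continuousOn_fst fun p hp => hp.1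
  have hcenter : ContinuousOn (fun p : ℝ × E => xbar p.1) (Ioo 0 1 ×ˢ univ) :=
    c.center_contDiffOn.continuousOn.comp continuousOn_fst fun p hp => hp.1
  have hgap : ContinuousOn (fun p : ℝ × E => R p.1 * ρ - ‖p.2 - xbar p.1‖) (Ioo 0 1 ×ˢ univ) :=
    (hscale.mul_const ρ).sub (continuousOn_snd.sub hcenter).norm
  convert hgap.isOpen_inter_preimage (isOpen_Ioo.prod isOpen_univ)
    (isOpen_Ioi (a := 0))
  ext p
  simp [movingBall]

theorem contDiffOn_homothetyVelocity (c : IsHomothetyPath R xbar) :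
    ContDiffOn ℝ 1 (fun p : ℝ × E => homothetyVelocity R xbar p.1 p.2) (Ioo 0 1 ×ˢ univ) := by
  have hfst : MapsTo Prod.fst (Ioo (0 : ℝ) 1 ×ˢ (univ : Set E)) (Ioo 0 1) := fun p hp => hp.1
  have hrate : ContDiffOn ℝ 1 (fun t => deriv R t / R t) (Ioo 0 1) :=
    c.contDiffOn_deriv_scale.div (c.scale_contDiffOn.of_le one_le_two) fun t ht =>
      (c.scale_pos t ht).ne'
  exact ((hrate.comp contDiffOn_fst hfst).smul (contDiffOn_snd.sub
    ((c.center_contDiffOn.of_le one_le_two).comp contDiffOn_fst hfst))).add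
      (c.contDiffOn_deriv_center.comp contDiffOn_fst hfst)

theorem acceleration_homothetyVelocity (c : IsHomothetyPath R xbar) (ht : t ∈ Ioo (0 : ℝ) 1)
    (x : E) :
    fderiv ℝ (homothetyVelocity R xbar t) x (homothetyVelocity R xbar t x)
        + deriv (fun s => homothetyVelocity R xbar s x) t
      = (deriv (deriv R) t / R t) • (x - xbar t) + deriv (deriv xbar) t := by
  have hR := (c.scale_pos t ht).ne'
  have htime : deriv (fun s => homothetyVelocity R xbar s x) t = _ :=
    ((((c.hasDerivAt_deriv_scale ht).div (c.hasDerivAt_scale ht) hR).smul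
      ((c.hasDerivAt_center ht).const_sub x)).add (c.hasDerivAt_deriv_center ht)).deriv
  rw [fderiv_homothetyVelocity_apply, htime, homothetyVelocity, Pi.div_apply]
  match_scalars <;> field_simp <;> ring

end IsHomothetyPath

end MovingBall

section ParabolicDensity

variable {d : ℕ} {A ρ : ℝ} {R : ℝ → ℝ} {xbar : ℝ → EuclideanSpace ℝ (Fin d)} {t : ℝ}

theorem homothetyDensity_parabolicDensity_eq (hR : 0 < R t) {y : EuclideanSpace ℝ (Fin d)}
    (hy : ‖y - xbar t‖ ≤ R t * ρ) :
    homothetyDensity (parabolicDensity A ρ) R xbar t y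
      = (R t ^ d)⁻¹ * (A * (ρ ^ 2 - (R t ^ 2)⁻¹ * ‖y - xbar t‖ ^ 2)) := by
  have hnorm : ‖(R t)⁻¹ • (y - xbar t)‖ = (R t)⁻¹ * ‖y - xbar t‖ := by
    rw [norm_smul, norm_inv, Real.norm_of_nonneg hR.le]
  rw [homothetyDensity, parabolicDensity_eq_of_norm_le (by rwa [hnorm, inv_mul_le_iff₀ hR]), hnorm,
    mul_pow, inv_pow]

theorem IsHomothetyPath.contDiffOn_homothetyDensity_parabolicDensity (c : IsHomothetyPath R xbar) :
    ContDiffOn ℝ 1 (fun p : ℝ × EuclideanSpace ℝ (Fin d) =>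
      homothetyDensity (parabolicDensity A ρ) R xbar p.1 p.2) (movingBall ρ R xbar) := by
  have hscale : ContDiffOn ℝ 1 (fun p : ℝ × EuclideanSpace ℝ (Fin d) => R p.1)
      (movingBall ρ R xbar) :=
    (c.scale_contDiffOn.of_le one_le_two).comp contDiffOn_fst fun p hp => hp.1
  have hcenter : ContDiffOn ℝ 1 (fun p : ℝ × EuclideanSpace ℝ (Fin d) => xbar p.1)
      (movingBall ρ R xbar) :=
    (c.center_contDiffOn.of_le one_le_two).comp contDiffOn_fst fun p hp => hp.1
  have hne (k : ℕ) (p) (hp : p ∈ movingBall ρ R xbar) : R p.1 ^ k ≠ 0 :=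
    pow_ne_zero k (c.scale_pos p.1 hp.1).ne'
  exact (((hscale.pow d).inv (hne d)).mul (contDiffOn_const.mul (contDiffOn_const.sub
    (((hscale.pow 2).inv (hne 2)).mul ((contDiffOn_snd.sub hcenter).norm_sq ℝ))))).congr
      fun p hp => homothetyDensity_parabolicDensity_eq (c.scale_pos p.1 hp.1) hp.2.le

theorem gradient_homothetyDensity_parabolicDensity (hR : 0 < R t) {x : EuclideanSpace ℝ (Fin d)}
    (hx : ‖x - xbar t‖ < R t * ρ) :
    gradient (homothetyDensity (parabolicDensity A ρ) R xbar t) x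
      = -(2 * A / R t ^ (d + 2)) • (x - xbar t) := by
  have hopen : IsOpen {y : EuclideanSpace ℝ (Fin d) | ‖y - xbar t‖ < R t * ρ} :=
    isOpen_lt (by fun_prop) continuous_const
  have hpoly : homothetyDensity (parabolicDensity A ρ) R xbar t =ᶠ[𝓝 x] fun y =>
      (R t ^ d)⁻¹ * (A * (ρ ^ 2 - (R t ^ 2)⁻¹ * ‖y - xbar t‖ ^ 2)) :=
    mem_of_superset (hopen.mem_nhds hx) fun y hy =>
      homothetyDensity_parabolicDensity_eq hR (le_of_lt hy)
  have hsq : HasFDerivAt (fun y => ‖y - xbar t‖ ^ 2)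
      (InnerProductSpace.toDual ℝ _ ((2 : ℝ) • (x - xbar t))) x :=
    (hasFDerivAt_comp_sub (f := fun y => ‖y‖ ^ 2) (xbar t)).2
      (hasGradientAt_norm_sq (x - xbar t)).hasFDerivAt
  rw [hpoly.gradient_eq]
  refine (hasGradientAt_iff_hasFDerivAt.2 (((((hsq.const_mul _).const_sub _).const_mul _).const_mul
    _).congr_fderiv ?_)).gradient
  ext y
  simp only [InnerProductSpace.toDual_apply_apply, real_inner_smul_left, smul_apply, neg_apply,
    smul_eq_mul]
  field_simp
  ring

end ParabolicDensity

/-- The left-hand side `-2 S ∇u + K (v · ∇v + ∂ₜ v)` of the momentum equation, with `S` in place of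
`V ^ (1 / 2)`. -/
noncomputable def momentumResidual {E : Type*} [NormedAddCommGroup E] [InnerProductSpace ℝ E]
    [CompleteSpace E] (S K : ℝ) (u : ℝ → E → ℝ) (v : ℝ → E → E) (t : ℝ) (x : E) : E :=
  -(2 * S) • gradient (u t) x + K • (fderiv ℝ (v t) x (v t x) + deriv (fun s => v s x) t)

theorem momentumResidual_congr {E : Type*} [NormedAddCommGroup E] [InnerProductSpace ℝ E]
    [CompleteSpace E] {U : Set (ℝ × E)} (hU : IsOpen U) {u u' : ℝ → E → ℝ} {v v' : ℝ → E → E}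
    (hu : EqOn (fun p => u p.1 p.2) (fun p => u' p.1 p.2) U)
    (hv : EqOn (fun p => v p.1 p.2) (fun p => v' p.1 p.2) U) {t : ℝ} {x : E} (hx : (t, x) ∈ U)
    (S K : ℝ) : momentumResidual S K u v t x = momentumResidual S K u' v' t x := by
  have hspace : ∀ᶠ y in 𝓝 x, (t, y) ∈ U := (hU.preimage (by fun_prop)).mem_nhds hx
  have htime : ∀ᶠ s in 𝓝 t, (s, x) ∈ U := (hU.preimage (by fun_prop)).mem_nhds hx
  have hut : u t =ᶠ[𝓝 x] u' t := hspace.mono fun y hy => hu hy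
  have hvt : v t =ᶠ[𝓝 x] v' t := hspace.mono fun y hy => hv hy
  have hvx : (fun s => v s x) =ᶠ[𝓝 t] fun s => v' s x := htime.mono fun s hs => hv hs
  rw [momentumResidual, momentumResidual, hut.gradient_eq, hvt.fderiv_eq, hvt.eq_of_nhds,
    hvx.deriv_eq]

theorem IsHomothetyPath.momentumResidual_eq {d : ℕ} {ρ : ℝ} {R : ℝ → ℝ}
    {xbar : ℝ → EuclideanSpace ℝ (Fin d)} {t : ℝ} (c : IsHomothetyPath R xbar)
    {x : EuclideanSpace ℝ (Fin d)} (hx : (t, x) ∈ movingBall ρ R xbar) (A S K : ℝ) :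
    momentumResidual S K (homothetyDensity (parabolicDensity A ρ) R xbar)
        (homothetyVelocity R xbar) t x
      = ((R t)⁻¹ * (K * deriv (deriv R) t + 4 * A * S / R t ^ (d + 1))) • (x - xbar t)
        + K • deriv (deriv xbar) t := by
  have hR := c.scale_pos t hx.1
  rw [momentumResidual, gradient_homothetyDensity_parabolicDensity hR hx.2,
    c.acceleration_homothetyVelocity hx.1]
  match_scalars <;> field_simp <;> ring

theorem forall_smul_sub_add_eq_zero_iff {E : Type*} [NormedAddCommGroup E] [NormedSpace ℝ E]
    [Nontrivial E] {r : ℝ} (hr : 0 < r) {a : ℝ} {e x₀ : E} :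
    (∀ x ∈ Metric.ball x₀ r, a • (x - x₀) + e = 0) ↔ e = 0 ∧ a = 0 := by
  refine ⟨fun h => ?_, fun ⟨he, ha⟩ x _ => by rw [he, ha, zero_smul, zero_add]⟩
  have he : e = 0 := by simpa using h x₀ (Metric.mem_ball_self hr)
  obtain ⟨y, hy⟩ := exists_norm_eq E (half_pos hr).le
  have hmem : x₀ + y ∈ Metric.ball x₀ r := by simpa [hy] using hr
  have hy_ne : y ≠ 0 := norm_ne_zero_iff.1 (hy ▸ (half_pos hr).ne')
  exact ⟨he, by simpa [he, hy_ne] using h _ hmem⟩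

theorem mul_add_sqrt_div_eq_zero_iff {r F K V A m q y : ℝ} {n : ℕ} (hr : 0 < r) (hF : 0 < F)
    (hK : 0 < K) (hm : m ≠ 0) (hA : m * (4 * A) = q * F) (hV : r ^ (2 * n) * V = (F / K) ^ 2) :
    K * y + 4 * A * √V / r ^ (n + 1) = 0 ↔ q * V + m * r * y = 0 := by
  have hV_nonneg : 0 ≤ V := nonneg_of_mul_nonneg_right (hV ▸ sq_nonneg _) (by positivity)
  have hroot : F = K * (r ^ n * √V) := by
    rw [mul_comm, ← div_eq_iff hK.ne', ← sq_eq_sq₀ (by positivity) (by positivity), ← hV, mul_pow,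
      Real.sq_sqrt hV_nonneg, ← pow_mul, mul_comm n]
  have hfactor : m * r * (K * y + 4 * A * √V / r ^ (n + 1)) = K * (q * V + m * r * y) := by
    have hsqrt := Real.sq_sqrt hV_nonneg
    field_simp
    linear_combination r * √V * hA + r * q * √V * hroot + K * q * r ^ (n + 1) * hsqrt
  rw [← mul_right_inj' (mul_ne_zero hm hr.ne'), hfactor, mul_zero, mul_eq_zero,
    or_iff_right hK.ne']

/-! ### Solutions of the system -/

section Congr

variable {d : ℕ} {μ μ' : ℝ → Measure (EuclideanSpace ℝ (Fin d))} {I J : Set ℝ} {t : ℝ}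
  {v : ℝ → EuclideanSpace ℝ (Fin d) → EuclideanSpace ℝ (Fin d)}

theorem ContinuityEquation.mono (h : ContinuityEquation I μ v) (hJ : J ⊆ I) :
    ContinuityEquation J μ v :=
  fun φ hφ hφc t₁ ht₁ t₂ ht₂ => h φ hφ hφc t₁ (hJ ht₁) t₂ (hJ ht₂)

theorem ContinuityEquation.congr (h : ContinuityEquation I μ v) (hI : I.OrdConnected)
    (hμ : EqOn μ μ' I) : ContinuityEquation I μ' v := by
  intro φ hφ hφc t₁ ht₁ t₂ ht₂ h12
  obtain ⟨hint, heq⟩ := h φ hφ hφc t₁ ht₁ t₂ ht₂ h12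
  have hcongr : EqOn (fun s => ∫ x, inner ℝ (gradient φ x) (v s x) ∂(μ s))
      (fun s => ∫ x, inner ℝ (gradient φ x) (v s x) ∂(μ' s)) (uIcc t₁ t₂) := fun s hs => by
    simp only [hμ (hI.uIcc_subset ht₁ ht₂ hs)]
  exact ⟨hint.congr fun s hs => hcongr (uIoc_subset_uIcc hs), by
    rw [← hμ ht₁, ← hμ ht₂, heq, intervalIntegral.integral_congr hcongr]⟩

theorem coefficientK_congr (hμ : μ t = μ' t) : coefficientK μ v t = coefficientK μ' v t := by
  rw [coefficientK, coefficientK, kineticV_congr hμ .rfl, hμ]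

end Congr

namespace IsParabolicProfile

variable {d : ℕ} {A ρ t : ℝ} {ν : Measure (EuclideanSpace ℝ (Fin d))} {R : ℝ → ℝ}
  {xbar : ℝ → EuclideanSpace ℝ (Fin d)} {Ω : Set (EuclideanSpace ℝ (Fin d))}

theorem memLp_id (h : IsParabolicProfile A ρ ν) : MemLp id 2 ν :=
  have := h.isProbabilityMeasure
  memLp_of_continuous_of_ae_norm_le h.ae_norm_le continuous_id 2

theorem homothetyDensity_pos_iff_norm_lt (h : IsParabolicProfile A ρ ν) (hR : 0 < R t)
    {y : EuclideanSpace ℝ (Fin d)} :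
    0 < homothetyDensity (parabolicDensity A ρ) R xbar t y ↔ ‖y - xbar t‖ < R t * ρ := by
  rw [homothetyDensity_pos_iff hR, h.density_pos_iff, norm_smul, norm_inv,
    Real.norm_of_nonneg hR.le, inv_mul_lt_iff₀ hR]

theorem movingHomothety_eq_withDensity (h : IsParabolicProfile A ρ ν) (hR : 0 < R t) :
    movingHomothety ν R xbar t = volume.withDensity fun y =>
      ENNReal.ofReal (homothetyDensity (parabolicDensity A ρ) R xbar t y) := by
  rw [h.eq_withDensity, movingHomothety_withDensity_ofReal
    (continuous_parabolicDensity A ρ).measurable hR]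

theorem ae_movingHomothety_iff (h : IsParabolicProfile A ρ ν) (hR : 0 < R t)
    {p : EuclideanSpace ℝ (Fin d) → Prop} :
    (∀ᵐ y ∂movingHomothety ν R xbar t, p y) ↔ ∀ᵐ y, ‖y - xbar t‖ < R t * ρ → p y := by
  rw [h.movingHomothety_eq_withDensity hR, ae_withDensity_ofReal_iff
    (continuous_homothetyDensity (continuous_parabolicDensity A ρ)).measurable]
  simp only [h.homothetyDensity_pos_iff_norm_lt hR]

theorem toReal_kineticV_eq (h : IsParabolicProfile A ρ ν) (hR : 0 < R t)
    {μ : ℝ → Measure (EuclideanSpace ℝ (Fin d))}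
    {v : ℝ → EuclideanSpace ℝ (Fin d) → EuclideanSpace ℝ (Fin d)}
    (hμ : movingHomothety ν R xbar t = μ t)
    (hv : ∀ y, ‖y - xbar t‖ < R t * ρ → v t y = homothetyVelocity R xbar t y) :
    (kineticV μ v t).toReal = homothetyEnergy (∫ x, ‖x‖ ^ 2 ∂ν) R xbar t := by
  have := h.isProbabilityMeasure
  have hae : v t =ᵐ[movingHomothety ν R xbar t] homothetyVelocity R xbar t :=
    (h.ae_movingHomothety_iff hR).2 (.of_forall hv)
  rw [← kineticV_congr (v := v) hμ .rfl, kineticV_movingHomothety h.memLp_id h.integral_id hR.ne'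
    hae, ENNReal.toReal_ofReal (homothetyEnergy_nonneg (by positivity))]

theorem movingHomothety_eq_densityMeasure (h : IsParabolicProfile A ρ ν) (hΩ : MeasurableSet Ω)
    (hR : 0 < R t) (hcurve : movingHomothety ν R xbar t Ωᶜ = 0) :
    movingHomothety ν R xbar t
      = densityMeasure Ω (homothetyDensity (parabolicDensity A ρ) R xbar t) := by
  rw [h.movingHomothety_eq_withDensity hR] at hcurve ⊢
  exact withDensity_ofReal_eq_densityMeasure hΩ hcurve

theorem mem_interior_of_norm_sub_lt (h : IsParabolicProfile A ρ ν) (hΩ : IsClosed Ω)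
    (hR : 0 < R t) (hcurve : movingHomothety ν R xbar t Ωᶜ = 0) {y : EuclideanSpace ℝ (Fin d)}
    (hy : ‖y - xbar t‖ < R t * ρ) : y ∈ interior Ω := by
  rw [h.movingHomothety_eq_withDensity hR] at hcurve
  exact setOf_pos_subset_interior hΩ
    (continuous_homothetyDensity (continuous_parabolicDensity A ρ)) hcurve
    ((h.homothetyDensity_pos_iff_norm_lt hR).2 hy)

theorem homothetyDensity_eq_zero_of_mem_frontier (h : IsParabolicProfile A ρ ν) (hΩ : IsClosed Ω)
    (hR : 0 < R t) (hcurve : movingHomothety ν R xbar t Ωᶜ = 0) {y : EuclideanSpace ℝ (Fin d)}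
    (hy : y ∈ frontier Ω) : homothetyDensity (parabolicDensity A ρ) R xbar t y = 0 :=
  le_antisymm
    (not_lt.1 fun hpos => hy.2 (h.mem_interior_of_norm_sub_lt hΩ hR hcurve
      ((h.homothetyDensity_pos_iff_norm_lt hR).1 hpos)))
    (homothetyDensity_nonneg h.density_nonneg hR y)

theorem eqOn_interior_homothetyDensity (h : IsParabolicProfile A ρ ν) (hΩ : MeasurableSet Ω)
    (hR : 0 < R t) (hcurve : movingHomothety ν R xbar t Ωᶜ = 0)
    {f : EuclideanSpace ℝ (Fin d) → ℝ} (hf : ContinuousOn f Ω) (hf_nonneg : ∀ x ∈ Ω, 0 ≤ f x)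
    (hμf : movingHomothety ν R xbar t = densityMeasure Ω f) :
    EqOn f (homothetyDensity (parabolicDensity A ρ) R xbar t) (interior Ω) := by
  have := h.isProbabilityMeasure
  have : IsFiniteMeasure (densityMeasure Ω f) := hμf ▸ inferInstance
  exact eqOn_interior_of_densityMeasure_eq hΩ hf hf_nonneg
    (continuous_homothetyDensity (continuous_parabolicDensity A ρ)).continuousOn
    (fun x _ => homothetyDensity_nonneg h.density_nonneg hR x)
    (hμf.symm.trans (h.movingHomothety_eq_densityMeasure hΩ hR hcurve))

theorem exists_scale_pow_mul_eq_iff (h : IsParabolicProfile A ρ ν) (hd : 0 < d) :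
    (∃ C, ∀ t ∈ Ioo (0 : ℝ) 1, R t ^ (2 * d) *
        (d * ρ ^ 2 * deriv R t ^ 2 + (d + 4) * ‖deriv xbar t‖ ^ 2) = C) ↔
      ∃ C, ∀ t ∈ Ioo (0 : ℝ) 1,
        R t ^ (2 * d) * homothetyEnergy (∫ x, ‖x‖ ^ 2 ∂ν) R xbar t = C := by
  have hd4 : (d : ℝ) + 4 ≠ 0 := by positivity
  have hscale (t : ℝ) : R t ^ (2 * d) *
        (d * ρ ^ 2 * deriv R t ^ 2 + (d + 4) * ‖deriv xbar t‖ ^ 2)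
      = (d + 4) * (R t ^ (2 * d) * homothetyEnergy (∫ x, ‖x‖ ^ 2 ∂ν) R xbar t) := by
    rw [homothetyEnergy, h.integral_norm_sq hd]
    field_simp
  simp only [hscale]
  refine ⟨fun ⟨C, hC⟩ => ⟨C / (d + 4), fun t ht => ?_⟩,
    fun ⟨C, hC⟩ => ⟨(d + 4) * C, fun t ht => ?_⟩⟩
  · rw [← hC t ht, mul_div_cancel_left₀ _ hd4]
  · rw [hC t ht]

end IsParabolicProfile

namespace IsHomothetyPath

variable {d : ℕ} {A ρ t K C : ℝ} {ν : Measure (EuclideanSpace ℝ (Fin d))} {R : ℝ → ℝ}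
  {xbar : ℝ → EuclideanSpace ℝ (Fin d)} {Ω : Set (EuclideanSpace ℝ (Fin d))}
  {u : ℝ → EuclideanSpace ℝ (Fin d) → ℝ}
  {v : ℝ → EuclideanSpace ℝ (Fin d) → EuclideanSpace ℝ (Fin d)}

theorem positivitySet_eq_movingBall (c : IsHomothetyPath R xbar) (h : IsParabolicProfile A ρ ν)
    (hΩ : IsClosed Ω) (hcurve : ∀ t ∈ Ioo (0 : ℝ) 1, movingHomothety ν R xbar t Ωᶜ = 0)
    (hu : ∀ t ∈ Ioo (0 : ℝ) 1,
      EqOn (u t) (homothetyDensity (parabolicDensity A ρ) R xbar t) (interior Ω)) :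
    positivitySet Ω u = movingBall ρ R xbar := by
  ext ⟨t, x⟩
  refine and_congr_right fun ht => ⟨fun ⟨hx, hpos⟩ => ?_, fun hx => ?_⟩
  · rwa [hu t ht hx, h.homothetyDensity_pos_iff_norm_lt (c.scale_pos t ht)] at hpos
  · have hxΩ := h.mem_interior_of_norm_sub_lt hΩ (c.scale_pos t ht) (hcurve t ht) hx
    exact ⟨hxΩ, (hu t ht hxΩ).symm ▸ (h.homothetyDensity_pos_iff_norm_lt (c.scale_pos t ht)).2 hx⟩

theorem eqOn_movingBall_homothetyVelocity (c : IsHomothetyPath R xbar)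
    (h : IsParabolicProfile A ρ ν) (hv : IsTangentField (movingHomothety ν R xbar) v)
    (hv_cont : ContinuousOn (fun p : ℝ × EuclideanSpace ℝ (Fin d) => v p.1 p.2)
      (movingBall ρ R xbar)) :
    EqOn (fun p : ℝ × EuclideanSpace ℝ (Fin d) => v p.1 p.2)
      (fun p => homothetyVelocity R xbar p.1 p.2) (movingBall ρ R xbar) := by
  have := h.isProbabilityMeasure
  refine eqOn_of_ae_ae_eq (μ := volume) (ν := volume) c.isOpen_movingBall hv_cont
    (c.contDiffOn_homothetyVelocity.continuousOn.mono fun p hp => ⟨hp.1, mem_univ _⟩) ?_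
  filter_upwards [(ae_restrict_iff' measurableSet_Icc).1
    (c.ae_eq_homothetyVelocity h.ae_norm_le hv)] with t ht
  by_cases htI : t ∈ Ioo (0 : ℝ) 1
  · filter_upwards [(h.ae_movingHomothety_iff (c.scale_pos t htI)).1
      (ht (Ioo_subset_Icc_self htI))] with x hx hxt using hx hxt.2
  · exact .of_forall fun x hx => absurd hx.1 htI

theorem tendsto_integral_of_eqOn_movingHomothety (c : IsHomothetyPath R xbar) [IsFiniteMeasure ν]
    {μ : ℝ → Measure (EuclideanSpace ℝ (Fin d))}
    (hμ : EqOn (movingHomothety ν R xbar) μ (Ioo 0 1)) {t₀ : ℝ} (ht₀ : t₀ ∈ Icc (0 : ℝ) 1)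
    (f : BoundedContinuousFunction (EuclideanSpace ℝ (Fin d)) ℝ) :
    Tendsto (fun t => ∫ x, f x ∂(μ t)) (𝓝[Ioo 0 1] t₀)
      (𝓝 (∫ x, f x ∂(movingHomothety ν R xbar t₀))) := by
  refine ((c.continuousOn_integral f.continuous f.norm_coe_le_norm t₀ ht₀).tendsto.mono_left
    (nhdsWithin_mono t₀ Ioo_subset_Icc_self)).congr' ?_
  filter_upwards [self_mem_nhdsWithin] with t ht
  rw [hμ ht]

theorem hasConstantK_iff_of_isParabolicProfile (c : IsHomothetyPath R xbar)
    (h : IsParabolicProfile A ρ ν) (hd : 0 < d) :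
    HasConstantK (movingHomothety ν R xbar) K ↔ 0 < K ∧
      IsTangentField (movingHomothety ν R xbar) (homothetyVelocity R xbar) ∧
        ∀ t ∈ Ioo (0 : ℝ) 1, R t ^ (2 * d) * homothetyEnergy (∫ x, ‖x‖ ^ 2 ∂ν) R xbar t
          = (4 * A * ρ ^ 2 / (d + 4) / K) ^ 2 := by
  have := h.isProbabilityMeasure
  have hA := h.amplitude_pos
  have hρ := h.radius_pos
  exact c.hasConstantK_iff h.ae_norm_le h.integral_id (by positivity) (h.densityFunctional_two hd)

theorem momentumResidual_eq_zero_of_curveSolvesSystem (c : IsHomothetyPath R xbar)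
    (h : IsParabolicProfile A ρ ν) (hΩ : IsClosed Ω)
    (hcurve : ∀ t ∈ Ioo (0 : ℝ) 1, movingHomothety ν R xbar t Ωᶜ = 0)
    (hsol : CurveSolvesSystem Ω (movingHomothety ν R xbar) K) {x : EuclideanSpace ℝ (Fin d)}
    (hx : (t, x) ∈ movingBall ρ R xbar) :
    momentumResidual √(homothetyEnergy (∫ x, ‖x‖ ^ 2 ∂ν) R xbar t) K
      (homothetyDensity (parabolicDensity A ρ) R xbar) (homothetyVelocity R xbar) t x = 0 := by
  obtain ⟨u, v, huμ, hv, hsys⟩ := hsol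
  have hu (s) (hs : s ∈ Ioo (0 : ℝ) 1) :
      EqOn (u s) (homothetyDensity (parabolicDensity A ρ) R xbar s) (interior Ω) :=
    h.eqOn_interior_homothetyDensity hΩ.measurableSet (c.scale_pos s hs) (hcurve s hs)
      (hsys.continuousOn_density.comp (f := (s, ·)) (by fun_prop) fun y hy => ⟨hs, hy⟩)
      (hsys.nonneg s hs) (huμ s hs)
  have hpos := c.positivitySet_eq_movingBall h hΩ hcurve hu
  have hvelocity := c.eqOn_movingBall_homothetyVelocity h hv
    (hpos ▸ hsys.contDiffOn_velocity.continuousOn)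
  have hdensity : EqOn (fun p : ℝ × EuclideanSpace ℝ (Fin d) => u p.1 p.2)
      (fun p => homothetyDensity (parabolicDensity A ρ) R xbar p.1 p.2) (movingBall ρ R xbar) :=
    fun p hp => hu p.1 hp.1
      (h.mem_interior_of_norm_sub_lt hΩ (c.scale_pos p.1 hp.1) (hcurve p.1 hp.1) hp.2)
  have henergy := h.toReal_kineticV_eq (c.scale_pos t hx.1)
    (μ := fun s => densityMeasure Ω (u s)) (huμ t hx.1)
    fun y hy => hvelocity (x := (t, y)) ⟨hx.1, hy⟩
  rw [← momentumResidual_congr c.isOpen_movingBall hdensity hvelocity hx, ← henergy]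
  exact hsys.momentum t x (hpos ▸ hx)

theorem curveSolvesSystem_of_momentumResidual_eq_zero (c : IsHomothetyPath R xbar)
    (h : IsParabolicProfile A ρ ν) (hd : 0 < d) (hΩ : IsClosed Ω)
    (hcurve : ∀ t ∈ Ioo (0 : ℝ) 1, movingHomothety ν R xbar t Ωᶜ = 0)
    (hK : HasConstantK (movingHomothety ν R xbar) K)
    (hmomentum : ∀ t x, (t, x) ∈ movingBall ρ R xbar →
      momentumResidual √(homothetyEnergy (∫ x, ‖x‖ ^ 2 ∂ν) R xbar t) K
        (homothetyDensity (parabolicDensity A ρ) R xbar) (homothetyVelocity R xbar) t x = 0) :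
    CurveSolvesSystem Ω (movingHomothety ν R xbar) K := by
  have := h.isProbabilityMeasure
  have hA := h.amplitude_pos
  have hρ := h.radius_pos
  obtain ⟨hK_pos, htangent, henergy⟩ := (c.hasConstantK_iff_of_isParabolicProfile h hd).1 hK
  have hμ : EqOn (movingHomothety ν R xbar) (fun t => densityMeasure Ω
      (homothetyDensity (parabolicDensity A ρ) R xbar t)) (Ioo 0 1) := fun t ht =>
    h.movingHomothety_eq_densityMeasure hΩ.measurableSet (c.scale_pos t ht) (hcurve t ht)
  have hpos := c.positivitySet_eq_movingBall h hΩ hcurve fun t _ => eqOn_refl _ _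
  refine ⟨_, _, hμ, htangent,
    { nonneg := fun t ht x _ => homothetyDensity_nonneg h.density_nonneg (c.scale_pos t ht) x
      continuousOn_density := c.continuousOn_homothetyDensity (continuous_parabolicDensity A ρ) Ω
      contDiffOn_density := hpos ▸ c.contDiffOn_homothetyDensity_parabolicDensity
      contDiffOn_velocity :=
        c.contDiffOn_homothetyVelocity.mono fun p hp => ⟨hp.1, mem_univ _⟩
      constantK := fun t ht => ?_
      momentum := fun t x hx => ?_
      continuity := (htangent.1.2.mono Ioo_subset_Icc_self).congr ordConnected_Ioo hμ
      no_flux := fun t ht x hx n _ => by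
        rw [h.homothetyDensity_eq_zero_of_mem_frontier hΩ (c.scale_pos t ht) (hcurve t ht) hx,
          zero_mul]
      initial := fun f => nhdsWithin_Ioo_eq_nhdsGT (zero_lt_one (α := ℝ)) ▸
        c.tendsto_integral_of_eqOn_movingHomothety hμ (left_mem_Icc.2 zero_le_one) f
      final := fun f => nhdsWithin_Ioo_eq_nhdsLT (zero_lt_one (α := ℝ)) ▸
        c.tendsto_integral_of_eqOn_movingHomothety hμ (right_mem_Icc.2 zero_le_one) f }⟩
  · rw [← coefficientK_congr (hμ ht)]
    exact (coefficientK_movingHomothety_eq_iff h.memLp_id h.integral_id (by positivity)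
      (h.densityFunctional_two hd) (c.scale_pos t ht) .rfl hK_pos).2 (henergy t ht)
  · rw [hpos] at hx
    rw [h.toReal_kineticV_eq (c.scale_pos t hx.1) (hμ hx.1) fun _ _ => rfl]
    exact hmomentum t x hx

theorem momentumResidual_eq_zero_iff (c : IsHomothetyPath R xbar) (h : IsParabolicProfile A ρ ν)
    (hd : 0 < d) (hK : 0 < K) (ht : t ∈ Ioo (0 : ℝ) 1)
    (henergy : R t ^ (2 * d) * homothetyEnergy (∫ x, ‖x‖ ^ 2 ∂ν) R xbar t
      = (4 * A * ρ ^ 2 / (d + 4) / K) ^ 2) :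
    (∀ x ∈ Metric.ball (xbar t) (R t * ρ),
      momentumResidual √(homothetyEnergy (∫ x, ‖x‖ ^ 2 ∂ν) R xbar t) K
        (homothetyDensity (parabolicDensity A ρ) R xbar) (homothetyVelocity R xbar) t x = 0) ↔
      deriv (deriv xbar) t = 0 ∧
        d * homothetyEnergy (∫ x, ‖x‖ ^ 2 ∂ν) R xbar t
          + (∫ x, ‖x‖ ^ 2 ∂ν) * R t * deriv (deriv R) t = 0 := by
  have : Nonempty (Fin d) := ⟨⟨0, hd⟩⟩
  have hR := c.scale_pos t ht
  have hA := h.amplitude_pos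
  have hρ := h.radius_pos
  have hm : (∫ x, ‖x‖ ^ 2 ∂ν) * (4 * A) = d * (4 * A * ρ ^ 2 / (d + 4)) := by
    rw [h.integral_norm_sq hd]
    ring
  rw [← mul_add_sqrt_div_eq_zero_iff hR (by positivity) hK
    (h.integral_norm_sq_pos hd).ne' hm henergy]
  calc _ ↔ _ := forall₂_congr fun x hx => by
        rw [c.momentumResidual_eq ⟨ht, mem_ball_iff_norm.1 hx⟩ A]
    _ ↔ _ := forall_smul_sub_add_eq_zero_iff (mul_pos hR hρ)
    _ ↔ _ := by rw [smul_eq_zero_iff_right hK.ne', mul_eq_zero_iff_left (inv_ne_zero hR.ne')]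

theorem curveSolvesSystem_iff (c : IsHomothetyPath R xbar) (h : IsParabolicProfile A ρ ν)
    (hd : 0 < d) (hΩ : IsClosed Ω)
    (hcurve : ∀ t ∈ Ioo (0 : ℝ) 1, movingHomothety ν R xbar t Ωᶜ = 0)
    (hK : HasConstantK (movingHomothety ν R xbar) K) :
    CurveSolvesSystem Ω (movingHomothety ν R xbar) K ↔
      (∀ t ∈ Ioo (0 : ℝ) 1, deriv (deriv xbar) t = 0) ∧ StrictConcaveOn ℝ (Icc 0 1) R := by
  obtain ⟨hK_pos, -, henergy⟩ := (c.hasConstantK_iff_of_isParabolicProfile h hd).1 hK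
  have hA := h.amplitude_pos
  have hρ := h.radius_pos
  have hm := h.integral_norm_sq_pos hd
  have hmomentum (t) (ht : t ∈ Ioo (0 : ℝ) 1) :=
    c.momentumResidual_eq_zero_iff h hd hK_pos ht (henergy t ht)
  have hode (hx : ∀ t ∈ Ioo (0 : ℝ) 1, deriv (deriv xbar) t = 0) :=
    c.scale_ode_iff_strictConcaveOn hd hm hx (by positivity) henergy
  constructor
  · intro hsol
    have hmotion (t) (ht : t ∈ Ioo (0 : ℝ) 1) := (hmomentum t ht).1 fun x hx =>
      c.momentumResidual_eq_zero_of_curveSolvesSystem h hΩ hcurve hsol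
        ⟨ht, mem_ball_iff_norm.1 hx⟩
    have hx := fun t ht => (hmotion t ht).1
    exact ⟨hx, (hode hx).1 fun t ht => (hmotion t ht).2⟩
  · rintro ⟨hx, hconcave⟩
    exact c.curveSolvesSystem_of_momentumResidual_eq_zero h hd hΩ hcurve hK fun t x hxt =>
      (hmomentum t hxt.1).2 ⟨hx t hxt.1, (hode hx).2 hconcave t hxt.1⟩ x
        (mem_ball_iff_norm.2 hxt.2)

theorem exists_hasConstantK (c : IsHomothetyPath R xbar) (h : IsParabolicProfile A ρ ν)
    (hd : 0 < d) (hx : ∀ t ∈ Ioo (0 : ℝ) 1, deriv (deriv xbar) t = 0)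
    (hC : ∀ t ∈ Ioo (0 : ℝ) 1,
      R t ^ (2 * d) * homothetyEnergy (∫ x, ‖x‖ ^ 2 ∂ν) R xbar t = C)
    (hconcave : StrictConcaveOn ℝ (Icc 0 1) R) :
    ∃ K, HasConstantK (movingHomothety ν R xbar) K := by
  have := h.isProbabilityMeasure
  have hA := h.amplitude_pos
  have hρ := h.radius_pos
  have hm := h.integral_norm_sq_pos hd
  have hC_pos := c.pos_of_scale_pow_mul_homothetyEnergy_eq hm hC hconcave
  have hscale : IntervalIntegrable (deriv R) volume 0 1 :=
    intervalIntegrable_deriv_of_antitoneOn one_pos c.scale_continuousOn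
      (fun t ht => c.hasDerivAt_scale ht) (c.strictAntiOn_deriv_scale hconcave).antitoneOn
  have hcenter : IntervalIntegrable (deriv xbar) volume 0 1 := by
    obtain ⟨w, hw⟩ := isOpen_Ioo.exists_is_const_of_deriv_eq_zero isPreconnected_Ioo
      (c.contDiffOn_deriv_center.differentiableOn one_ne_zero) hx
    refine (intervalIntegrable_const (c := w)).congr_uIoo fun t ht => ?_
    exact (hw t (uIoo_of_le (zero_le_one (α := ℝ)) ▸ ht)).symm
  refine ⟨4 * A * ρ ^ 2 / (d + 4) / √C, (c.hasConstantK_iff_of_isParabolicProfile h hd).2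
    ⟨by positivity, c.isTangentField_of_exists h.ae_norm_le
      (c.isVelocityField_of_intervalIntegrable h.ae_norm_le hscale hcenter), fun t ht => ?_⟩⟩
  rw [hC t ht, div_div_cancel₀ (by positivity), Real.sq_sqrt hC_pos.le]

theorem center_eq_affine_iff (c : IsHomothetyPath R xbar) :
    (∀ t ∈ Icc (0 : ℝ) 1, xbar t = (1 - t) • xbar 0 + t • xbar 1) ↔
      ∀ t ∈ Ioo (0 : ℝ) 1, deriv (deriv xbar) t = 0 := by
  rw [forall_deriv_deriv_eq_zero_iff_exists_affine zero_lt_one c.center_continuousOn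
    (c.center_contDiffOn.differentiableOn two_ne_zero)
    (c.contDiffOn_deriv_center.differentiableOn one_ne_zero)]
  constructor
  · refine fun h => ⟨xbar 1 - xbar 0, fun t ht => (h t ht).trans ?_⟩
    module
  · rintro ⟨w, hw⟩ t ht
    rw [hw t ht, hw 1 (right_mem_Icc.2 zero_le_one)]
    module

theorem exists_hasConstantK_and_curveSolvesSystem_iff (c : IsHomothetyPath R xbar)
    (h : IsParabolicProfile A ρ ν) (hd : 0 < d) (hΩ : IsClosed Ω)
    (hcurve : ∀ t ∈ Ioo (0 : ℝ) 1, movingHomothety ν R xbar t Ωᶜ = 0) :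
    (∃ K, HasConstantK (movingHomothety ν R xbar) K ∧
        CurveSolvesSystem Ω (movingHomothety ν R xbar) K) ↔
      (∀ t ∈ Ioo (0 : ℝ) 1, deriv (deriv xbar) t = 0) ∧
        (∃ C, ∀ t ∈ Ioo (0 : ℝ) 1,
          R t ^ (2 * d) * homothetyEnergy (∫ x, ‖x‖ ^ 2 ∂ν) R xbar t = C) ∧
        StrictConcaveOn ℝ (Icc 0 1) R := by
  constructor
  · rintro ⟨K, hK, hsol⟩
    obtain ⟨hx, hconcave⟩ := (c.curveSolvesSystem_iff h hd hΩ hcurve hK).1 hsol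
    exact ⟨hx, ⟨_, ((c.hasConstantK_iff_of_isParabolicProfile h hd).1 hK).2.2⟩, hconcave⟩
  · rintro ⟨hx, ⟨C, hC⟩, hconcave⟩
    obtain ⟨K, hK⟩ := c.exists_hasConstantK h hd hx hC hconcave
    exact ⟨K, hK, (c.curveSolvesSystem_iff h hd hΩ hcurve hK).2 ⟨hx, hconcave⟩⟩

end IsHomothetyPath

end WassersteinConformal

theorem mainTheorem6_general {d : ℕ} (hd : 0 < d) {Ω : Set (EuclideanSpace ℝ (Fin d))}
    (hΩ : IsClosed Ω) {A ρ : ℝ} {μbar : Measure (EuclideanSpace ℝ (Fin d))}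
    (hμbar : WassersteinConformal.IsParabolicProfile A ρ μbar)
    {R : ℝ → ℝ} {xbar : ℝ → EuclideanSpace ℝ (Fin d)}
    (hpath : WassersteinConformal.IsHomothetyPath R xbar)
    (hcurve : ∀ t ∈ Ioo (0 : ℝ) 1, WassersteinConformal.movingHomothety μbar R xbar t Ωᶜ = 0) :
    (∀ K : ℝ,
      WassersteinConformal.HasConstantK (WassersteinConformal.movingHomothety μbar R xbar) K →
        (WassersteinConformal.CurveSolvesSystem Ω
            (WassersteinConformal.movingHomothety μbar R xbar) K ↔
          (∀ t ∈ Icc (0 : ℝ) 1, xbar t = (1 - t) • xbar 0 + t • xbar 1) ∧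
            StrictConcaveOn ℝ (Icc 0 1) R)) ∧
    ((∃ K : ℝ,
        WassersteinConformal.HasConstantK (WassersteinConformal.movingHomothety μbar R xbar) K ∧
        WassersteinConformal.CurveSolvesSystem Ω
          (WassersteinConformal.movingHomothety μbar R xbar) K) ↔
      (∀ t ∈ Ioo (0 : ℝ) 1, deriv (deriv xbar) t = 0) ∧
        (∃ C : ℝ, ∀ t ∈ Ioo (0 : ℝ) 1,
          R t ^ (2 * d) * (d * ρ ^ 2 * deriv R t ^ 2 + (d + 4) * ‖deriv xbar t‖ ^ 2) = C) ∧
        StrictConcaveOn ℝ (Icc 0 1) R) := by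
  rw [hpath.center_eq_affine_iff, hμbar.exists_scale_pow_mul_eq_iff hd]
  exact ⟨fun K hK => hpath.curveSolvesSystem_iff hμbar hd hΩ hcurve hK,
    hpath.exists_hasConstantK_and_curveSolvesSystem_iff hμbar hd hΩ hcurve⟩

theorem mainTheorem6 (d : ℕ) (hd : 0 < d)
    (Ω : Set (EuclideanSpace ℝ (Fin d))) (hΩ_closed : IsClosed Ω) (hΩ_convex : Convex ℝ Ω)
    -- the reference measure
    (A ρ : ℝ) (hρ : 0 < ρ) (μbar : Measure (EuclideanSpace ℝ (Fin d)))
    (hμbar_prob : IsProbabilityMeasure μbar)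
    (hμbar : μbar = volume.withDensity
      fun x : EuclideanSpace ℝ (Fin d) => ENNReal.ofReal (A * max (ρ ^ 2 - ‖x‖ ^ 2) 0))
    (hμbar_Ω : μbar Ωᶜ = 0)
    -- the curve
    (a b : EuclideanSpace ℝ (Fin d)) (ha : a ∈ Ω) (hb : b ∈ Ω)
    (R : ℝ → ℝ) (xbar : ℝ → EuclideanSpace ℝ (Fin d))
    (hR_cont : ContinuousOn R (Icc 0 1)) (hR_smooth : ContDiffOn ℝ 2 R (Ioo 0 1))
    (hR_pos : ∀ t ∈ Ioo (0 : ℝ) 1, 0 < R t)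
    (hx_cont : ContinuousOn xbar (Icc 0 1)) (hx_smooth : ContDiffOn ℝ 2 xbar (Ioo 0 1))
    (hx_zero : xbar 0 = a) (hx_one : xbar 1 = b)
    (hcurve_Ω : ∀ t ∈ Icc (0 : ℝ) 1, WassersteinConformal.movingHomothety μbar R xbar t Ωᶜ = 0) :
    (∀ K : ℝ,
      WassersteinConformal.HasConstantK (WassersteinConformal.movingHomothety μbar R xbar) K →
        (WassersteinConformal.CurveSolvesSystem Ω
            (WassersteinConformal.movingHomothety μbar R xbar) K ↔
          (∀ t ∈ Icc (0 : ℝ) 1, xbar t = (1 - t) • a + t • b) ∧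
            StrictConcaveOn ℝ (Icc 0 1) R)) ∧
    ((∃ K : ℝ,
        WassersteinConformal.HasConstantK (WassersteinConformal.movingHomothety μbar R xbar) K ∧
        WassersteinConformal.CurveSolvesSystem Ω
          (WassersteinConformal.movingHomothety μbar R xbar) K) ↔
      (∀ t ∈ Ioo (0 : ℝ) 1, deriv (deriv xbar) t = 0) ∧
        (∃ C : ℝ, ∀ t ∈ Ioo (0 : ℝ) 1,
          R t ^ (2 * d) * (d * ρ ^ 2 * deriv R t ^ 2 + (d + 4) * ‖deriv xbar t‖ ^ 2) = C) ∧
        StrictConcaveOn ℝ (Icc 0 1) R) := by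
  subst hx_zero hx_one
  exact mainTheorem6_general hd hΩ_closed ⟨hρ, hμbar_prob, hμbar⟩
    ⟨hR_cont, hR_smooth, hR_pos, hx_cont, hx_smooth⟩ fun t ht => hcurve_Ω t (Ioo_subset_Icc_self ht)
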